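/- Let $f_1,f_2:\mathbb{R}^2\to\mathbb{R}^2$ be the similitudes $f_1(x,y)=\left(\frac{x-y}{2},\frac{x+y}{2}\right)$ and $f_2(x,y)=\left(\frac{x+y+1}{2},\frac{y-x+1}{2}\right)$, and for $A\subset\mathbb{R}^2$ put $F(A)=f_1(A)\cup f_2(A)$. Let $K$ be the Lévy dragon, i.e. the unique nonempty compact set with $K=F(K)$, and let $\partial K$ be its topological boundary in $\mathbb{R}^2$. Let $T_0$ be the closed triangle with vertices $(0,0)$, $(1/2,1/2)$, $(1,0)$. For $k\ge 0$ let $B_k$ be the set of words $I=(i_1,\dots,i_k)\in\{1,2\}^k$ such that $f_{i_1}\circ\cdots\circ f_{i_k}(T_0)\cap\partial F^k(T_0)\neq\emptyset$. **Theorem.** The limit $\beta=\lim_{k\to\infty}|B_k|^{1/k}$ exists, $\beta\ge 1$, and, with $\alpha=\frac{\ln\beta}{\ln\sqrt2}$, $$\dim_H\partial K=\alpha\qquad\text{and}\qquad 0<\mathcal{H}^{\alpha}(\partial K)<\infty,$$ where $\dim_H$ is the Hausdorff dimension and $\mathcal{H}^{\alpha}$ the $\alpha$-dimensional Hausdorff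 measure for the Euclidean metric. -/

import Mathlib

noncomputable section

namespace LevyDragon

open TopologicalSpace
open scoped NNReal

/-- The Euclidean plane. -/
abbrev Plane : Type := EuclideanSpace ℝ (Fin 2)

/-- The similitudes `f₁ (x, y) = ((x - y) / 2, (x + y) / 2)` (index `0`) and
`f₂ (x, y) = ((x + y + 1) / 2, (y - x + 1) / 2)` (index `1`). -/
def f (i : Fin 2) (p : Plane) : Plane :=
  if i = 0 then !₂[(p 0 - p 1) / 2, (p 0 + p 1) / 2]
  else !₂[(p 0 + p 1 + 1) / 2, (p 1 - p 0 + 1) / 2]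

/-- The set map `F(A) = f₁(A) ∪ f₂(A)`. -/
def F (A : Set Plane) : Set Plane := f 0 '' A ∪ f 1 '' A

/-- The contraction ratio `1 / √2` of both similitudes. -/
def ratio : ℝ≥0 := (NNReal.sqrt 2)⁻¹

theorem coe_ratio : (ratio : ℝ) = (√2)⁻¹ := by
  simp [ratio, Real.coe_sqrt]

theorem ratio_lt_one : ratio < 1 := by
  rw [← NNReal.coe_lt_coe, coe_ratio, NNReal.coe_one]
  apply inv_lt_one_of_one_lt₀
  rw [Real.lt_sqrt] <;> norm_num

theorem dist_f (i : Fin 2) (p q : Plane) : dist (f i p) (f i q) = ratio * dist p q := by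
  have h2 : (ratio : ℝ) ^ 2 = 1 / 2 := by
    rw [coe_ratio, inv_pow, Real.sq_sqrt (by norm_num)]; norm_num
  rw [← sq_eq_sq₀ dist_nonneg (by positivity), mul_pow, h2, EuclideanSpace.dist_sq_eq,
    EuclideanSpace.dist_sq_eq]
  fin_cases i <;> simp [f, Fin.sum_univ_two, Real.dist_eq, sq_abs] <;> ring

theorem lipschitzWith_f (i : Fin 2) : LipschitzWith ratio (f i) :=
  LipschitzWith.of_dist_le_mul fun p q => (dist_f i p q).le

theorem continuous_f (i : Fin 2) : Continuous (f i) := (lipschitzWith_f i).continuous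

/-- The map `F` on the space of nonempty compact sets, with the Hausdorff metric. -/
def hutchinson (A : NonemptyCompacts Plane) : NonemptyCompacts Plane :=
  A.map (f 0) (continuous_f 0) ⊔ A.map (f 1) (continuous_f 1)

theorem coe_hutchinson (A : NonemptyCompacts Plane) :
    (hutchinson A : Set Plane) = F (A : Set Plane) := rfl

theorem infEDist_image_le (i : Fin 2) (A B : NonemptyCompacts Plane) (x : Plane)
    (hx : x ∈ f i '' (A : Set Plane)) :
    Metric.infEDist x (F (B : Set Plane)) ≤ ratio * edist A B := by
  obtain ⟨a, ha, rfl⟩ := hx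
  obtain ⟨b, hb, hab⟩ := B.isCompact.exists_infEDist_eq_edist B.nonempty a
  have hmem : f i b ∈ F (B : Set Plane) := by
    fin_cases i
    · exact Or.inl ⟨b, hb, rfl⟩
    · exact Or.inr ⟨b, hb, rfl⟩
  calc Metric.infEDist (f i a) (F (B : Set Plane)) ≤ edist (f i a) (f i b) :=
        Metric.infEDist_le_edist_of_mem hmem
    _ ≤ ratio * edist a b := lipschitzWith_f i a b
    _ ≤ ratio * edist A B := by
        gcongr
        rw [← hab]
        exact Metric.infEDist_le_hausdorffEDist_of_mem ha

theorem contracting_hutchinson : ContractingWith ratio hutchinson := by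
  refine ⟨ratio_lt_one, fun A B => ?_⟩
  refine Metric.hausdorffEDist_le_of_infEDist ?_ ?_
  · rintro x (hx | hx)
    · exact infEDist_image_le 0 A B x hx
    · exact infEDist_image_le 1 A B x hx
  · rw [edist_comm A B]
    rintro x (hx | hx)
    · exact infEDist_image_le 0 B A x hx
    · exact infEDist_image_le 1 B A x hx

/-- The attractor of `{f₁, f₂}` as a nonempty compact set: the unique fixed point of the
contraction `F` on the space of nonempty compact sets. -/
def dragon : NonemptyCompacts Plane :=
  ContractingWith.fixedPoint hutchinson contracting_hutchinson

/-- The Lévy dragon as a set of points. -/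
def K : Set Plane := dragon

/-- `K` is the unique nonempty compact set `A` with `A = f₁(A) ∪ f₂(A)`. -/
theorem eq_K_iff (A : Set Plane) : A = K ↔ A.Nonempty ∧ IsCompact A ∧ A = F A := by
  constructor
  · rintro rfl
    refine ⟨dragon.nonempty, dragon.isCompact, ?_⟩
    have h : hutchinson dragon = dragon := contracting_hutchinson.fixedPoint_isFixedPt
    rw [K, ← coe_hutchinson, h]
  · rintro ⟨hne, hc, hA⟩
    have h : hutchinson ⟨⟨A, hc⟩, hne⟩ = ⟨⟨A, hc⟩, hne⟩ := NonemptyCompacts.ext hA.symm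
    have h' : (⟨⟨A, hc⟩, hne⟩ : NonemptyCompacts Plane) = dragon :=
      contracting_hutchinson.fixedPoint_unique h
    exact congrArg (fun C : NonemptyCompacts Plane => (C : Set Plane)) h'

/-- The closed triangle with vertices `(0, 0)`, `(1/2, 1/2)`, `(1, 0)`. -/
def T₀ : Set Plane := convexHull ℝ {!₂[0, 0], !₂[1 / 2, 1 / 2], !₂[1, 0]}

/-- The composition `f_{i₁} ∘ f_{i₂} ∘ ⋯ ∘ f_{iₖ}` for a word `I = (i₁, …, iₖ)`. -/
def fWord {k : ℕ} (I : Fin k → Fin 2) (p : Plane) : Plane := (List.ofFn I).foldr f p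

/-- `B k` is the set of words `I` of length `k` whose triangle `f_I(T₀)` meets the topological
boundary of `F^k(T₀)`. -/
def B (k : ℕ) : Set (Fin k → Fin 2) :=
  {I | (fWord I '' T₀ ∩ frontier (F^[k] T₀)).Nonempty}

end LevyDragon

end

/-!
The plane is identified with `ℂ`. The similitudes replace the directed edge `0 → 1` by the two legs
of the isosceles right triangle to its left, and the same rule turns the directed edges of the
lattice `ℤ[i]` into the directed edges of the lattice `θ • ℤ[i]`, `θ = (1 + i) / 2`, each of which
arises exactly once (`parent_child`, `child_letter_parent`). Directed edges correspond to the
orientation preserving lattice motions, so they form a group `Edge`, and the rule is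
`e ↦ refine e * leg i` with a homomorphism `refine`. Copies of the triangle, or of the dragon `D`,
on all edges of `θ ^ k • ℤ[i]` cover the plane; copies on two edges can meet only if the edges are
`Near`, a relation that passes to parents.

Let `bdry k 1` be the set of those descendants of the edge `0 → 1` after `k` refinements that are
near some edge which is not such a descendant, and `bdryCount k` its cardinality. The boundary of
the dragon consists of its points that lie in the copy of the dragon on another edge
(`mem_frontier_D`), so it is covered by the tiles on `bdry k 1`. That other copies do not reach the
interior of the dragon comes from one explicit edge all of whose neighbours descend from `0 → 1`
(`exists_core`). Up to constant factors `bdryCount k` is also the number of words in `B k`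
(`card_inner_le_ncard_B`, `ncard_B_le_bdryCount`).

The sequence `bdryCount` is submultiplicative, since ancestors of near edges are near
(`bdryCount_add_le`). It is supermultiplicative up to a constant (`bdryCount_mul_le`) for the
following reason. `bdryCount m` is comparable to the total number, over all relative positions of
two distinct near edges, of the near pairs that descend from them in `m` steps. Only finitely many
relative positions occur. Those in `table` are connected to each other by refinement, and they
dominate the other ones: with suitable weights, the number of
near pairs grows at least like `(3 / 2) ^ m` for the former and at most like `(3 / 2) ^ m` for the
latter. Near every boundary edge there is a pair of edges, one inside and one outside, in a position
of `table` (`exists_mem_inner_near`). Fekete's lemma now gives `β ≥ 1` with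
`β ^ k ≤ bdryCount k ≤ M * β ^ k` (`exists_growth_rate`).

With `α = log β / log √2`, a tile of level `k` has a diameter comparable to `ρ ^ k`, where
`ρ = 1 / √2` and `(ρ ^ k) ^ α = β ^ (-k)`. The coverings by the tiles on `bdry k 1` therefore show
that the `α`-dimensional measure of the boundary is finite. Conversely, a set of diameter at most
`ρ ^ k` meets boundedly many tiles of level `k`, hence at most a constant times `β ^ (m - k)` tiles
on boundary edges of level `m`. As there are at least `β ^ m` boundary edges of level `m`, the sum
of `β ^ (-k)` over a finite covering is bounded below (`one_le_sum_of_cover`), and the measure of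
the boundary is positive. Thus `α` is the Hausdorff dimension.
-/

/-! ### Directed edges of the square lattice -/

namespace LevyDragon

/-- The four Gaussian units `1, i, -1, -i`, as the powers of `i`. -/
def dir : Fin 4 → GaussianInt := ![1, ⟨0, 1⟩, -1, ⟨0, -1⟩]

theorem dir_zero : dir 0 = 1 := rfl

theorem dir_add : ∀ r s : Fin 4, dir (r + s) = dir r * dir s := by decide

theorem norm_dir : ∀ r : Fin 4, (dir r).norm = 1 := by decide

theorem norm_dir_sub_dir : ∀ r s : Fin 4, (dir r - dir s).norm ≤ 4 := by decide

theorem dir_parity : ∀ r : Fin 4, ((dir r).re + (dir r).im) % 2 = 1 := by decide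

/-- A directed edge `a → a + i ^ r` of the square lattice `ℤ[i]`. Such an edge is identified with
the orientation preserving lattice motion `z ↦ a + i ^ r z` that carries the edge `0 → 1` to it,
so that edges form a group, with `1` the edge `0 → 1`. -/
@[ext]
structure Edge where
  /-- The initial point. -/
  pt : GaussianInt
  /-- The direction, an exponent of `i`. -/
  rot : Fin 4
deriving DecidableEq

namespace Edge

instance : Mul Edge := ⟨fun e e' => ⟨e.pt + dir e.rot * e'.pt, e.rot + e'.rot⟩⟩

instance : One Edge := ⟨⟨0, 0⟩⟩

instance : Inv Edge := ⟨fun e => ⟨-(dir (-e.rot) * e.pt), -e.rot⟩⟩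

theorem mul_pt (e e' : Edge) : (e * e').pt = e.pt + dir e.rot * e'.pt := rfl

theorem mul_rot (e e' : Edge) : (e * e').rot = e.rot + e'.rot := rfl

theorem one_pt : (1 : Edge).pt = 0 := rfl

theorem one_rot : (1 : Edge).rot = 0 := rfl

theorem inv_pt (e : Edge) : (e⁻¹).pt = -(dir (-e.rot) * e.pt) := rfl

theorem inv_rot (e : Edge) : (e⁻¹).rot = -e.rot := rfl

instance : Group Edge :=
  Group.ofLeftAxioms
    (fun a b c => by
      ext1
      · simp only [mul_pt, mul_rot, dir_add]; ring
      · simp only [mul_rot, add_assoc])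
    (fun a => by
      ext1
      · simp only [mul_pt, one_pt, one_rot, dir_zero]; ring
      · simp only [mul_rot, one_rot, zero_add])
    (fun a => by
      ext1
      · simp only [mul_pt, inv_pt, inv_rot, one_pt]; ring
      · simp only [mul_rot, inv_rot, one_rot, neg_add_cancel])

/-- Refinement of the lattice by the factor `(1 + i) / 2`: the coordinates of a motion of `ℤ[i]`
with respect to the lattice `(1 + i) / 2 • ℤ[i]`. -/
def refine : Edge →* Edge where
  toFun e := ⟨⟨1, -1⟩ * e.pt, e.rot⟩
  map_one' := by ext1 <;> simp [one_pt, one_rot]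
  map_mul' a b := by
    ext1
    · simp only [mul_pt]; ring
    · simp only [mul_rot]

theorem refine_pt (e : Edge) : (refine e).pt = ⟨1, -1⟩ * e.pt := rfl

theorem refine_rot (e : Edge) : (refine e).rot = e.rot := rfl

/-- The two edges that replace the edge `0 → 1` in the refined lattice: the legs of the isosceles
right triangle to its left. -/
def leg : Fin 2 → Edge := ![1, ⟨1, 3⟩]

/-- The two edges of the refined lattice that replace an edge. -/
def child (i : Fin 2) (e : Edge) : Edge := refine e * leg i

theorem child_mul (i : Fin 2) (h e : Edge) : child i (h * e) = refine h * child i e := by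
  simp only [child, map_mul, mul_assoc]

/-- Which of the two children of its parent an edge is. -/
def letter (t : Edge) : Fin 2 := if (t.pt.re + t.pt.im) % 2 = 0 then 0 else 1

/-- The edge that has `t` as one of its children. The quotient by `1 - i` in `ℤ[i]` is exact
here. -/
def parent (t : Edge) : Edge :=
  if (t.pt.re + t.pt.im) % 2 = 0 then
    ⟨⟨(t.pt.re - t.pt.im) / 2, (t.pt.re + t.pt.im) / 2⟩, t.rot⟩
  else
    ⟨⟨((t.pt - dir (t.rot + 1)).re - (t.pt - dir (t.rot + 1)).im) / 2,
      ((t.pt - dir (t.rot + 1)).re + (t.pt - dir (t.rot + 1)).im) / 2⟩, t.rot + 1⟩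

theorem child_zero (e : Edge) : child 0 e = ⟨⟨1, -1⟩ * e.pt, e.rot⟩ := by
  simp [child, leg, Edge.ext_iff, refine_pt, refine_rot]

theorem child_one (e : Edge) : child 1 e = ⟨⟨1, -1⟩ * e.pt + dir e.rot, e.rot + 3⟩ := by
  simp [child, leg, Edge.ext_iff, mul_pt, mul_rot, refine_pt, refine_rot]

theorem parent_child (i : Fin 2) (e : Edge) : parent (child i e) = e := by
  have h := dir_parity e.rot
  have h4 : ∀ r : Fin 4, r + 3 + 1 = r := by decide
  fin_cases i
  · simp only [Fin.zero_eta, child_zero, parent]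
    rw [if_pos (by simp; omega)]
    ext <;> simp <;> omega
  · simp only [Fin.mk_one, child_one, parent]
    rw [if_neg (by simp; omega)]
    simp only [h4]
    ext <;> simp <;> omega

theorem child_letter_parent (t : Edge) : child (letter t) (parent t) = t := by
  have h := dir_parity (t.rot + 1)
  have h4 : ∀ r : Fin 4, r + 1 + 3 = r := by decide
  by_cases ht : (t.pt.re + t.pt.im) % 2 = 0
  · simp only [letter, parent, if_pos ht, child_zero]
    ext <;> simp <;> omega
  · simp only [letter, parent, if_neg ht, child_one, h4]
    ext <;> simp <;> omega

theorem letter_child (i : Fin 2) (e : Edge) : letter (child i e) = i := by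
  have h := dir_parity e.rot
  fin_cases i
  · simp only [Fin.zero_eta, child_zero, letter]
    rw [if_pos (by simp; omega)]
  · simp only [Fin.mk_one, child_one, letter]
    rw [if_neg (by simp; omega)]

theorem parent_eq_iff {t e : Edge} : parent t = e ↔ ∃ i, t = child i e :=
  ⟨fun h => ⟨letter t, by rw [← h, child_letter_parent]⟩, by rintro ⟨i, rfl⟩; exact parent_child i e⟩

theorem parent_refine_mul (h t : Edge) : parent (refine h * t) = h * parent t := by
  conv_lhs => rw [← child_letter_parent t, ← child_mul, parent_child]

theorem iterate_parent_refine_mul (m : ℕ) (h t : Edge) :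
    parent^[m] (refine^[m] h * t) = h * parent^[m] t := by
  induction m generalizing t with
  | zero => rfl
  | succ m ih =>
    rw [Function.iterate_succ_apply, Function.iterate_succ_apply', parent_refine_mul, ih,
      Function.iterate_succ_apply]

/-- Twice the midpoint of an edge. -/
def mid (e : Edge) : GaussianInt := 2 * e.pt + dir e.rot

theorem mid_mul (h e : Edge) : mid (h * e) = 2 * h.pt + dir h.rot * mid e := by
  simp only [mid, mul_pt, mul_rot, dir_add]; ring

/-- Four times the squared distance between the midpoints of two edges. -/
def sep (e e' : Edge) : ℤ := (mid e' - mid e).norm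

theorem sep_mul_left (h e e' : Edge) : sep (h * e) (h * e') = sep e e' := by
  have : mid (h * e') - mid (h * e) = dir h.rot * (mid e' - mid e) := by
    simp only [mid_mul]; ring
  rw [sep, this, Zsqrtd.norm_mul, norm_dir, one_mul, sep]

theorem sep_one_inv_mul (e e' : Edge) : sep 1 (e⁻¹ * e') = sep e e' := by
  rw [← sep_mul_left e]; simp

theorem sep_comm (e e' : Edge) : sep e e' = sep e' e := by
  rw [sep, sep, ← Zsqrtd.norm_neg, neg_sub]

theorem sep_self (e : Edge) : sep e e = 0 := by simp [sep]

/-- Edges at distance so small that their dragons may meet (`near_of_mem_tile`). -/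
def Near (e e' : Edge) : Prop := sep e e' ≤ 23

instance (e e' : Edge) : Decidable (Near e e') := inferInstanceAs (Decidable (_ ≤ _))

theorem Near.symm {e e' : Edge} (h : Near e e') : Near e' e := by
  rwa [Near, sep_comm] at h

theorem near_self (e : Edge) : Near e e := by simp [Near, sep_self]

theorem near_mul_left {h e e' : Edge} : Near (h * e) (h * e') ↔ Near e e' := by
  rw [Near, Near, sep_mul_left]

theorem near_one_inv_mul {e e' : Edge} : Near 1 (e⁻¹ * e') ↔ Near e e' := by
  rw [Near, Near, sep_one_inv_mul]

theorem mid_child (i : Fin 2) (e : Edge) :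
    ∃ r : Fin 4, mid (child i e) = ⟨1, -1⟩ * mid e + dir r := by
  have h1 : ∀ r : Fin 4, dir r = ⟨1, -1⟩ * dir r + dir (r + 1) := by decide
  have h2 : ∀ r : Fin 4, 2 * dir r + dir (r + 3) = ⟨1, -1⟩ * dir r + dir r := by decide
  fin_cases i
  · refine ⟨e.rot + 1, ?_⟩
    simp only [Fin.zero_eta, child_zero, mid]
    rw [mul_add, add_assoc, ← h1]; ring
  · refine ⟨e.rot, ?_⟩
    simp only [Fin.mk_one, child_one, mid]
    rw [mul_add, mul_add, add_assoc, h2]; ring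

/-- Nearness passes to parents. The constant `23` in `Near` is large enough for this. -/
theorem near_of_near_child {i j : Fin 2} {e e' : Edge} (h : Near (child i e) (child j e')) :
    Near e e' := by
  obtain ⟨r, hr⟩ := mid_child i e
  obtain ⟨s, hs⟩ := mid_child j e'
  have h4 := norm_dir_sub_dir s r
  have hd : mid (child j e') - mid (child i e)
      = ⟨1, -1⟩ * (mid e' - mid e) + (dir s - dir r) := by rw [hr, hs]; ring
  unfold Near sep at h ⊢
  rw [hd] at h
  generalize dir s - dir r = η at *
  generalize mid e' - mid e = Δ at *
  obtain ⟨p, q⟩ := Δ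
  obtain ⟨s, t⟩ := η
  simp [Zsqrtd.norm] at h h4 ⊢
  -- `|x - y|² ≤ (7 / 5) |x|² + (7 / 2) |y|²` with `x` the separation of the children, `y = η`
  nlinarith [sq_nonneg (2 * (p + q + s) + 5 * s), sq_nonneg (2 * (-p + q + t) + 5 * t)]

theorem near_parent {t t' : Edge} (h : Near t t') : Near (parent t) (parent t') := by
  rw [← child_letter_parent t, ← child_letter_parent t'] at h
  exact near_of_near_child h

theorem near_iterate_parent (m : ℕ) {t t' : Edge} (h : Near t t') :
    Near (parent^[m] t) (parent^[m] t') := by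
  induction m generalizing t t' with
  | zero => exact h
  | succ m ih => exact ih (near_parent h)

/-- The descendants of an edge after `m` refinements. -/
def desc : ℕ → Edge → Finset Edge
  | 0, e => {e}
  | m + 1, e => desc m (child 0 e) ∪ desc m (child 1 e)

theorem mem_desc {m : ℕ} {e t : Edge} : t ∈ desc m e ↔ parent^[m] t = e := by
  induction m generalizing e with
  | zero => simp [desc]
  | succ m ih =>
    rw [desc, Finset.mem_union, ih, ih, Function.iterate_succ_apply', parent_eq_iff]
    simp [Fin.exists_fin_two]

theorem disjoint_desc_child (m : ℕ) (e : Edge) :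
    Disjoint (desc m (child 0 e)) (desc m (child 1 e)) := by
  rw [Finset.disjoint_left]
  intro t h0 h1
  rw [mem_desc] at h0 h1
  have := congrArg letter (h0.symm.trans h1)
  simp [letter_child] at this

theorem dir_bounds : ∀ r : Fin 4, -1 ≤ (dir r).re ∧ (dir r).re ≤ 1 ∧ -1 ≤ (dir r).im ∧
    (dir r).im ≤ 1 := by decide

theorem sep_one (q : Edge) : sep 1 q = (2 * q.pt.re + (dir q.rot).re - 1) ^ 2 +
    (2 * q.pt.im + (dir q.rot).im) ^ 2 := by
  simp [sep, mid, Zsqrtd.norm, one_pt, one_rot, dir_zero]; ring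

/-- Only finitely many edges lie within a given distance of the edge `0 → 1`. -/
theorem finite_sep_le (R : ℤ) : {q : Edge | sep 1 q ≤ R}.Finite := by
  have hinj : Function.Injective fun q : Edge => (q.pt.re, q.pt.im, q.rot) := by
    rintro ⟨⟨a, b⟩, r⟩ ⟨⟨a', b'⟩, r'⟩ h
    simpa [and_assoc] using h
  refine (Set.Finite.preimage hinj.injOn ((Finset.Icc (-R - 1) (R + 2) ×ˢ
    Finset.Icc (-R - 1) (R + 2) ×ˢ (Finset.univ : Finset (Fin 4))).finite_toSet)).subset ?_
  intro q hq
  rw [Set.mem_ofPred_eq, sep_one] at hq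
  obtain ⟨h1, h2, h3, h4⟩ := dir_bounds q.rot
  have hx : |2 * q.pt.re + (dir q.rot).re - 1| ≤ R := by
    nlinarith [Int.natAbs_le_self_sq (2 * q.pt.re + (dir q.rot).re - 1),
      Int.natCast_natAbs (2 * q.pt.re + (dir q.rot).re - 1),
      sq_nonneg (2 * q.pt.im + (dir q.rot).im)]
  have hy : |2 * q.pt.im + (dir q.rot).im| ≤ R := by
    nlinarith [Int.natAbs_le_self_sq (2 * q.pt.im + (dir q.rot).im),
      Int.natCast_natAbs (2 * q.pt.im + (dir q.rot).im),
      sq_nonneg (2 * q.pt.re + (dir q.rot).re - 1)]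
  rw [abs_le] at hx hy
  simp only [Finset.coe_product, Set.mem_preimage, Set.mem_prod, Finset.mem_coe, Finset.mem_Icc,
    Finset.mem_univ, and_true]
  omega

/-- A box that contains all edges near the edge `0 → 1`. -/
def box : Finset Edge :=
  (Finset.range 6 ×ˢ Finset.range 5 ×ˢ (Finset.univ : Finset (Fin 4))).image
    fun p => ⟨⟨p.1 - 2, p.2.1 - 2⟩, p.2.2⟩

theorem mem_box_of_near {q : Edge} (h : Near 1 q) : q ∈ box := by
  unfold Near at h
  rw [sep_one] at h
  obtain ⟨h1, h2, h3, h4⟩ := dir_bounds q.rot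
  have hx : |2 * q.pt.re + (dir q.rot).re - 1| < 5 :=
    abs_lt_of_sq_lt_sq (by nlinarith [sq_nonneg (2 * q.pt.im + (dir q.rot).im)]) (by norm_num)
  have hy : |2 * q.pt.im + (dir q.rot).im| < 5 :=
    abs_lt_of_sq_lt_sq (by nlinarith [sq_nonneg (2 * q.pt.re + (dir q.rot).re - 1)]) (by norm_num)
  rw [abs_lt] at hx hy
  refine Finset.mem_image.2 ⟨((q.pt.re + 2).toNat, (q.pt.im + 2).toNat, q.rot), ?_, ?_⟩
  · simp only [Finset.mem_product, Finset.mem_range, Finset.mem_univ, and_true]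
    omega
  · ext <;> simp <;> omega

end Edge

end LevyDragon

/-! ### Relative positions of near edges -/

namespace LevyDragon

namespace Edge

/-- The position, relative to the `i`-th child of the edge `0 → 1`, of the `j`-th child of `q`
(`leg_mul_nbr`). -/
def nbr (q : Edge) : Fin 2 → Fin 2 → Edge
  | 0, 0 => ⟨⟨q.pt.re + q.pt.im, q.pt.im - q.pt.re⟩, q.rot⟩
  | 0, 1 => ⟨⟨q.pt.re + q.pt.im + (dir q.rot).re, q.pt.im - q.pt.re + (dir q.rot).im⟩, q.rot + 3⟩
  | 1, 0 => ⟨⟨q.pt.re - q.pt.im, q.pt.re + q.pt.im - 1⟩, q.rot + 1⟩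
  | 1, 1 => ⟨⟨q.pt.re - q.pt.im - (dir q.rot).im, q.pt.re + q.pt.im + (dir q.rot).re - 1⟩, q.rot⟩

theorem leg_mul_nbr (q : Edge) (i j : Fin 2) : leg i * nbr q i j = refine q * leg j := by
  have h3 : dir 3 = ⟨0, -1⟩ := rfl
  have h4 : ∀ r : Fin 4, 3 + (r + 1) = r := by decide
  fin_cases i <;> fin_cases j <;>
    ext <;> simp [nbr, leg, mul_pt, mul_rot, refine_pt, refine_rot, h3, h4] <;>
    first | ring | rw [add_comm]

theorem child_inv_mul_child (i j : Fin 2) (e e' : Edge) :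
    (child i e)⁻¹ * child j e' = nbr (e⁻¹ * e') i j := by
  rw [inv_mul_eq_iff_eq_mul, child, child, mul_assoc, leg_mul_nbr, map_mul, map_inv, mul_assoc,
    mul_inv_cancel_left]

/-- The squared distance `sep 1 q` in a form that is fast to evaluate. -/
def gap (q : Edge) : ℤ :=
  (2 * q.pt.re + (dir q.rot).re - 1) * (2 * q.pt.re + (dir q.rot).re - 1) +
    (2 * q.pt.im + (dir q.rot).im) * (2 * q.pt.im + (dir q.rot).im)

theorem gap_eq (q : Edge) : gap q = sep 1 q := by rw [sep_one, gap]; ring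

theorem gap_le_iff {q : Edge} : gap q ≤ 23 ↔ Near 1 q := by rw [gap_eq, Near]

/-- The relative positions of two distinct edges whose dragons meet in a large set. Each entry
consists of the relative position, a weight (`three_mul_weight_le`), and the lengths of shortest
paths, along the relation between `q` and `nbr q i j`, to and from the entry `⟨0, 1⟩`. -/
def table : List (Edge × ℕ × ℕ × ℕ) :=
  [(⟨⟨-1, -1⟩, 0⟩, 1, 6, 9), (⟨⟨-1, 0⟩, 0⟩, 3, 6, 8), (⟨⟨-1, 0⟩, 3⟩, 2, 5, 6),
    (⟨⟨-1, 1⟩, 0⟩, 1, 6, 2), (⟨⟨-1, 1⟩, 3⟩, 3, 4, 5), (⟨⟨0, -1⟩, 0⟩, 1, 7, 9),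
    (⟨⟨0, -1⟩, 1⟩, 2, 7, 9), (⟨⟨0, 0⟩, 1⟩, 2, 0, 0), (⟨⟨0, 0⟩, 3⟩, 2, 8, 8),
    (⟨⟨0, 1⟩, 0⟩, 1, 7, 1), (⟨⟨0, 1⟩, 1⟩, 2, 5, 3), (⟨⟨0, 1⟩, 2⟩, 3, 3, 5),
    (⟨⟨0, 1⟩, 3⟩, 3, 5, 7), (⟨⟨0, 2⟩, 3⟩, 3, 4, 4), (⟨⟨1, -1⟩, 0⟩, 1, 6, 9),
    (⟨⟨1, -1⟩, 1⟩, 2, 8, 8), (⟨⟨1, 0⟩, 0⟩, 3, 2, 8), (⟨⟨1, 0⟩, 1⟩, 3, 1, 7),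
    (⟨⟨1, 0⟩, 2⟩, 2, 4, 8), (⟨⟨1, 0⟩, 3⟩, 2, 3, 9), (⟨⟨1, 1⟩, 0⟩, 1, 6, 2),
    (⟨⟨1, 1⟩, 1⟩, 3, 4, 4), (⟨⟨1, 1⟩, 2⟩, 3, 2, 6), (⟨⟨1, 1⟩, 3⟩, 2, 8, 8),
    (⟨⟨1, 2⟩, 3⟩, 2, 5, 3), (⟨⟨2, -1⟩, 1⟩, 2, 5, 6), (⟨⟨2, 0⟩, 1⟩, 3, 4, 5),
    (⟨⟨2, 1⟩, 2⟩, 3, 3, 5)]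

/-- The relative positions listed in `table`. -/
def big : List Edge := table.map Prod.fst

/-- The weight of a relative position in `table`, and `0` for other relative positions. -/
def weight (q : Edge) : ℕ := ((table.lookup q).map Prod.fst).getD 0

/-- A weight for the relative positions of near edges outside of `table`. It makes the weights of
the refinements of such a position sum to at most `3 / 2` times its own weight
(`low_of_mem_box`). -/
def lowWeight (q : Edge) : ℕ :=
  if 23 < gap q then 0 else ([
    (⟨⟨1, 2⟩, 2⟩, 12), (⟨⟨0, 0⟩, 2⟩, 10), (⟨⟨2, 0⟩, 2⟩, 10), (⟨⟨-1, 2⟩, 3⟩, 8),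
    (⟨⟨2, 1⟩, 1⟩, 8), (⟨⟨-2, 0⟩, 0⟩, 6), (⟨⟨2, 0⟩, 0⟩, 6), (⟨⟨1, -1⟩, 2⟩, 3),
    (⟨⟨-1, 0⟩, 1⟩, 2), (⟨⟨0, -1⟩, 3⟩, 2), (⟨⟨1, -2⟩, 1⟩, 2), (⟨⟨2, 1⟩, 3⟩, 2)].lookup q).getD 1

theorem near_of_mem_big : ∀ q ∈ big, gap q ≤ 23 ∧ q ≠ 1 := by decide +kernel

/-- Under refinement the total weight of positions in `table` grows at least by the factor
`3 / 2`. -/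
theorem three_mul_weight_le : ∀ q ∈ big, 1 ≤ weight q ∧ weight q ≤ 3 ∧ 3 * weight q ≤
    2 * (weight (nbr q 0 0) + weight (nbr q 0 1) + weight (nbr q 1 0) + weight (nbr q 1 1)) := by
  decide +kernel

theorem weight_eq_zero {q : Edge} (h : q ∉ big) : weight q = 0 := by
  rw [weight, List.lookup_eq_none_iff.2 ?_]
  · rfl
  · intro r hr
    rw [bne_iff_ne]
    rintro rfl
    exact h (List.mem_map_of_mem hr)

/-- Positions outside of `table` stay outside of it under refinement, and their total weight grows
at most by the factor `3 / 2`. -/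
theorem low_of_mem_box :
    ∀ q ∈ box, gap q ≤ 23 → q ≠ 1 → q ∉ big →
      (∀ i j, nbr q i j ∉ big) ∧ 1 ≤ lowWeight q ∧
      2 * (lowWeight (nbr q 0 0) + lowWeight (nbr q 0 1) + lowWeight (nbr q 1 0) +
        lowWeight (nbr q 1 1)) ≤ 3 * lowWeight q := by decide +kernel

theorem table_path_to : ∀ r ∈ table, r.2.2.1 = 0 ∧ r.1 = ⟨0, 1⟩ ∨
    ∃ r' ∈ table, r'.2.2.1 + 1 = r.2.2.1 ∧ ∃ i j, nbr r.1 i j = r'.1 := by decide +kernel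

theorem table_path_from : ∀ r ∈ table, r.2.2.2 = 0 ∧ r.1 = ⟨0, 1⟩ ∨
    ∃ r' ∈ table, r'.2.2.2 + 1 = r.2.2.2 ∧ ∃ i j, nbr r'.1 i j = r.1 := by decide +kernel

/-- The reversed edge `1 → 0` and the edges perpendicular to `0 → 1` that start at one of its end
points. -/
def touch : List Edge := [⟨0, 1⟩, ⟨0, 3⟩, ⟨1, 1⟩, ⟨1, 2⟩, ⟨1, 3⟩]

theorem inv_mem_big_of_mem_touch : ∀ g ∈ touch, g⁻¹ ∈ big := by decide +kernel

/-- From each edge near `0 → 1` a step of `touch` leads closer to `0 → 1`. The reversed edge has the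
same midpoint, so that `gap` does not decrease in the last step. -/
theorem exists_touch_of_box : ∀ q ∈ box, gap q ≤ 23 → q ≠ 1 →
    ∃ g ∈ touch, q * g = 1 ∨ gap (q * g) < gap q := by decide +kernel

/-- Along this word, the ancestors of all edges near the last descendant of `0 → 1` coalesce to the
edge `0 → 1`. The map `q ↦ parent (leg i * q)` gives the position of the parent of an edge relative
to the parent of its neighbour (`iterate_parent_foldl`). -/
theorem core_of_box : ∀ q ∈ box, gap q ≤ 23 →
    [0, 1, 0, 1, 1, 1, 0, 1, 0, 1, 0, 1, 1, 0, 1, 1, 0, 1, 1].foldr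
      (fun i q => parent (leg i * q)) q = 1 := by decide +kernel

end Edge

end LevyDragon

/-! ### Counting boundary edges -/

namespace LevyDragon

namespace Edge

open Finset

/-- The number of pairs of near edges that descend from given edges after `m` refinements. -/
def nearPairs (m : ℕ) (e e' : Edge) : ℕ :=
  ∑ t ∈ desc m e, ∑ t' ∈ desc m e', if Near t t' then 1 else 0

theorem nearPairs_eq_zero {m : ℕ} {e e' : Edge} (h : ¬ Near e e') : nearPairs m e e' = 0 := by
  refine sum_eq_zero fun t ht => sum_eq_zero fun t' ht' => if_neg fun hn => h ?_
  rw [← mem_desc.1 ht, ← mem_desc.1 ht']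
  exact near_iterate_parent m hn

theorem nearPairs_succ (m : ℕ) (e e' : Edge) : nearPairs (m + 1) e e' =
    ∑ i, ∑ j, nearPairs m (child i e) (child j e') := by
  simp only [nearPairs, desc, sum_union (disjoint_desc_child _ _), Fin.sum_univ_two,
    sum_add_distrib]
  ring

/-- The number of pairs of near edges, one a descendant of the edge `0 → 1` and the other a
descendant of `q`, after `m` refinements. -/
def pairCount (m : ℕ) (q : Edge) : ℕ := nearPairs m 1 q

theorem nearPairs_eq_pairCount (m : ℕ) (e e' : Edge) :
    nearPairs m e e' = pairCount m (e⁻¹ * e') := by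
  induction m generalizing e e' with
  | zero => simp only [nearPairs, pairCount, desc, sum_singleton, near_one_inv_mul]
  | succ m ih =>
    rw [pairCount, nearPairs_succ, nearPairs_succ]
    refine sum_congr rfl fun i _ => sum_congr rfl fun j _ => ?_
    rw [ih, ih (child i 1), child_inv_mul_child, child_inv_mul_child, inv_one, one_mul]

theorem pairCount_succ (m : ℕ) (q : Edge) :
    pairCount (m + 1) q = ∑ i, ∑ j, pairCount m (nbr q i j) := by
  rw [pairCount, nearPairs_succ]
  refine sum_congr rfl fun i _ => sum_congr rfl fun j _ => ?_
  rw [nearPairs_eq_pairCount, child_inv_mul_child, inv_one, one_mul]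

theorem pairCount_zero {q : Edge} (h : Near 1 q) : pairCount 0 q = 1 := by
  simp only [pairCount, nearPairs, desc, sum_singleton, if_pos h]

theorem pairCount_eq_zero {m : ℕ} {q : Edge} (h : ¬ Near 1 q) : pairCount m q = 0 :=
  nearPairs_eq_zero h

theorem pairCount_nbr_le (m : ℕ) (q : Edge) (i j : Fin 2) :
    pairCount m (nbr q i j) ≤ pairCount (m + 1) q := by
  rw [pairCount_succ]
  exact (single_le_sum (f := fun j => pairCount m (nbr q i j)) (fun _ _ => Nat.zero_le _)
    (mem_univ j)).trans (single_le_sum (f := fun i => ∑ j, pairCount m (nbr q i j))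
      (fun _ _ => Nat.zero_le _) (mem_univ i))

theorem near_of_big {q : Edge} (h : q ∈ big) : Near 1 q := gap_le_iff.1 (near_of_mem_big q h).1

theorem nbr_ne_one {q : Edge} (h : q ≠ 1) (i j : Fin 2) : nbr q i j ≠ 1 := by
  intro hq
  have h1 := child_inv_mul_child i j 1 q
  rw [inv_one, one_mul, hq, inv_mul_eq_one] at h1
  apply h
  rw [← parent_child j q, ← h1, parent_child]

/-- Outside of `table`, the number of near pairs grows at most like `(3 / 2) ^ m`. -/
theorem two_pow_mul_pairCount_le (m : ℕ) {q : Edge} (hn : Near 1 q) (h1 : q ≠ 1) (hq : q ∉ big) :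
    2 ^ m * pairCount m q ≤ 3 ^ m * lowWeight q := by
  induction m generalizing q with
  | zero =>
    rw [pairCount_zero hn]
    simpa using (low_of_mem_box q (mem_box_of_near hn) (gap_le_iff.2 hn) h1 hq).2.1
  | succ m ih =>
    obtain ⟨hb, -, hw⟩ :=
      low_of_mem_box q (mem_box_of_near hn) (gap_le_iff.2 hn) h1 hq
    have key : ∀ i j, 2 ^ m * pairCount m (nbr q i j) ≤ 3 ^ m * lowWeight (nbr q i j) := by
      intro i j
      by_cases hij : Near 1 (nbr q i j)
      · exact ih hij (nbr_ne_one h1 i j) (hb i j)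
      · simp [pairCount_eq_zero hij]
    simp only [pairCount_succ, Fin.sum_univ_two]
    have h3 := Nat.mul_le_mul_left (3 ^ m) hw
    rw [pow_succ, pow_succ]
    linarith [key 0 0, key 0 1, key 1 0, key 1 1]

/-- For the relative positions in `table`, the number of near pairs grows at least like
`(3 / 2) ^ m`. -/
theorem three_pow_mul_weight_le (m : ℕ) (q : Edge) :
    3 ^ m * weight q ≤ 3 * (2 ^ m * pairCount m q) := by
  induction m generalizing q with
  | zero =>
    by_cases hq : q ∈ big
    · rw [pairCount_zero (near_of_big hq)]
      simpa using (three_mul_weight_le q hq).2.1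
    · simp [weight_eq_zero hq]
  | succ m ih =>
    by_cases hq : q ∈ big
    · have h3 := Nat.mul_le_mul_left (3 ^ m) (three_mul_weight_le q hq).2.2
      simp only [pairCount_succ, Fin.sum_univ_two]
      rw [pow_succ, pow_succ]
      linarith [ih (nbr q 0 0), ih (nbr q 0 1), ih (nbr q 1 0), ih (nbr q 1 1)]
    · simp [weight_eq_zero hq]

theorem pairCount_le_add (m n : ℕ) : pairCount m ⟨0, 1⟩ ≤ pairCount (m + n) ⟨0, 1⟩ := by
  induction n with
  | zero => rfl
  | succ n ih =>
    have h : nbr ⟨0, 1⟩ 0 0 = ⟨0, 1⟩ := by decide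
    have := pairCount_nbr_le (m + n) ⟨0, 1⟩ 0 0
    rw [h] at this
    exact ih.trans this

theorem pairCount_le_of_path_to (n : ℕ) : ∀ r ∈ table, r.2.2.1 = n → ∀ m,
    pairCount m ⟨0, 1⟩ ≤ pairCount (m + n) r.1 := by
  induction n with
  | zero =>
    intro r hr h0 m
    obtain h | ⟨r', -, h, -⟩ := table_path_to r hr
    · rw [h.2]; rfl
    · omega
  | succ n ih =>
    intro r hr h0 m
    obtain h | ⟨r', hr', h, i, j, hij⟩ := table_path_to r hr
    · omega
    · have := pairCount_nbr_le (m + n) r.1 i j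
      rw [hij] at this
      exact (ih r' hr' (by omega) m).trans this

theorem pairCount_le_of_path_from (n : ℕ) : ∀ r ∈ table, r.2.2.2 = n → ∀ m,
    pairCount m r.1 ≤ pairCount (m + n) ⟨0, 1⟩ := by
  induction n with
  | zero =>
    intro r hr h0 m
    obtain h | ⟨r', -, h, -⟩ := table_path_from r hr
    · rw [h.2]; rfl
    · omega
  | succ n ih =>
    intro r hr h0 m
    obtain h | ⟨r', hr', h, i, j, hij⟩ := table_path_from r hr
    · omega
    · have := pairCount_nbr_le m r'.1 i j
      rw [hij] at this
      have h2 := ih r' hr' (by omega) (m + 1)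
      rw [show m + 1 + n = m + (n + 1) by ring] at h2
      exact this.trans h2

theorem table_path_bound : ∀ r ∈ table, r.2.2.1 ≤ 9 ∧ r.2.2.2 ≤ 9 := by decide +kernel

/-- The relative positions in `table` are connected to each other by refinement. -/
theorem pairCount_le_of_mem_big {p q : Edge} (hp : p ∈ big) (hq : q ∈ big) (m : ℕ) :
    pairCount m q ≤ pairCount (m + 18) p := by
  obtain ⟨r, hr, rfl⟩ := List.mem_map.1 hp
  obtain ⟨r', hr', rfl⟩ := List.mem_map.1 hq
  have h1 := pairCount_le_of_path_from _ r' hr' rfl m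
  have h2 := pairCount_le_add (m + r'.2.2.2) (18 - r.2.2.1 - r'.2.2.2)
  have h3 := pairCount_le_of_path_to _ r hr rfl
    (m + r'.2.2.2 + (18 - r.2.2.1 - r'.2.2.2))
  have h4 := table_path_bound r hr
  have h5 := table_path_bound r' hr'
  rw [show m + r'.2.2.2 + (18 - r.2.2.1 - r'.2.2.2) + r.2.2.1 = m + 18 by omega] at h3
  exact h1.trans (h2.trans h3)

theorem lowWeight_le : ∀ q ∈ box, lowWeight q ≤ 12 := by decide +kernel

/-- The positions in `table` dominate all positions of distinct near edges. The factor `36` is the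
product of the bounds for the two weights. -/
theorem pairCount_le (m : ℕ) {p q : Edge} (hp : p ∈ big) (hn : Near 1 q) (h1 : q ≠ 1) :
    pairCount m q ≤ 36 * pairCount (m + 18) p := by
  by_cases hq : q ∈ big
  · have := pairCount_le_of_mem_big hp hq m
    omega
  · have hl := two_pow_mul_pairCount_le m hn h1 hq
    have hw := lowWeight_le q (mem_box_of_near hn)
    have hb := three_pow_mul_weight_le m p
    have hp1 := (three_mul_weight_le p hp).1
    have hpp := pairCount_le_of_mem_big hp hp m
    have h2 : 0 < 2 ^ m := by positivity
    have : 2 ^ m * pairCount m q ≤ 2 ^ m * (36 * pairCount m p) := by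
      calc _ ≤ 3 ^ m * lowWeight q := hl
        _ ≤ 3 ^ m * 12 := by gcongr
        _ ≤ 12 * (3 ^ m * weight p) := by nlinarith [Nat.zero_le (3 ^ m)]
        _ ≤ 12 * (3 * (2 ^ m * pairCount m p)) := by gcongr
        _ = _ := by ring
    have := Nat.le_of_mul_le_mul_left this h2
    omega

open Classical in
/-- The descendants of `e` after `m` refinements that are near some edge which does not descend
from `e`. -/
noncomputable def bdry (m : ℕ) (e : Edge) : Finset Edge :=
  {t ∈ desc m e | ∃ t', Near t t' ∧ parent^[m] t' ≠ e}

theorem mem_bdry {m : ℕ} {e t : Edge} :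
    t ∈ bdry m e ↔ parent^[m] t = e ∧ ∃ t', Near t t' ∧ parent^[m] t' ≠ e := by
  simp [bdry, mem_desc]

theorem refine_mul_mem_bdry {m : ℕ} {e t : Edge} (h : Edge) (ht : t ∈ bdry m e) :
    refine^[m] h * t ∈ bdry m (h * e) := by
  rw [mem_bdry] at ht ⊢
  obtain ⟨ht, t', hn, ht'⟩ := ht
  refine ⟨by rw [iterate_parent_refine_mul, ht], refine^[m] h * t', near_mul_left.2 hn, ?_⟩
  rw [iterate_parent_refine_mul]
  exact fun hh => ht' (mul_left_cancel hh)

/-- The number of boundary edges after `m` refinements. -/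
noncomputable def bdryCount (m : ℕ) : ℕ := (bdry m 1).card

theorem card_bdry_le_card_bdry_mul (m : ℕ) (h e : Edge) :
    (bdry m e).card ≤ (bdry m (h * e)).card :=
  card_le_card_of_injOn (fun t => refine^[m] h * t) (fun _ ht => refine_mul_mem_bdry h ht)
    (fun _ _ _ _ hh => mul_left_cancel hh)

theorem card_bdry (m : ℕ) (e : Edge) : (bdry m e).card = bdryCount m := by
  apply le_antisymm
  · simpa [bdryCount] using card_bdry_le_card_bdry_mul m e⁻¹ e
  · simpa [bdryCount] using card_bdry_le_card_bdry_mul m e 1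

theorem iterate_parent_mem_bdry {k m : ℕ} {e t : Edge} (ht : t ∈ bdry (k + m) e) :
    parent^[m] t ∈ bdry k e := by
  rw [mem_bdry] at ht ⊢
  obtain ⟨ht, t', hn, ht'⟩ := ht
  rw [Function.iterate_add_apply] at ht ht'
  exact ⟨ht, _, near_iterate_parent m hn, ht'⟩

theorem mem_bdry_iterate_parent {k m : ℕ} {e t : Edge} (ht : t ∈ bdry (k + m) e) :
    t ∈ bdry m (parent^[m] t) := by
  rw [mem_bdry] at ht ⊢
  obtain ⟨ht, t', hn, ht'⟩ := ht
  rw [Function.iterate_add_apply] at ht ht'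
  exact ⟨rfl, t', hn, fun hh => ht' (by rw [hh, ht])⟩

/-- A boundary edge is a boundary edge relative to each of its ancestors, and the ancestors are
boundary edges themselves. -/
theorem bdryCount_add_le (k m : ℕ) : bdryCount (k + m) ≤ bdryCount k * bdryCount m := by
  rw [mul_comm]
  refine card_le_mul_card_image_of_maps_to (f := parent^[m])
    (fun t ht => iterate_parent_mem_bdry ht) _ fun s _ => ?_
  rw [← card_bdry m s]
  refine card_le_card fun t ht => ?_
  obtain ⟨ht, hs⟩ := mem_filter.1 ht
  exact hs ▸ mem_bdry_iterate_parent ht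

/-- The edges that are near `t`. -/
def nearSet (t : Edge) : Finset Edge := {t' ∈ box.image (t * ·) | Near t t'}

theorem mem_nearSet {t t' : Edge} : t' ∈ nearSet t ↔ Near t t' := by
  rw [nearSet, mem_filter, and_iff_right_iff_imp]
  intro h
  exact mem_image.2 ⟨t⁻¹ * t', mem_box_of_near (near_one_inv_mul.2 h), by simp⟩

theorem card_nearSet_le (t : Edge) : (nearSet t).card ≤ 120 :=
  ((card_filter_le _ _).trans card_image_le).trans (by decide +kernel)

/-- Boundary edges are counted by near pairs, and hence by near pairs for any position in `table`. -/
theorem bdryCount_le (m : ℕ) {p : Edge} (hp : p ∈ big) :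
    bdryCount m ≤ 120 * 36 * pairCount (m + 18) p := by
  have h1 : bdryCount m ≤ ∑ q ∈ (nearSet 1).erase 1, pairCount m q := by
    simp only [pairCount, nearPairs]
    rw [sum_comm, bdryCount, bdry, card_filter]
    refine sum_le_sum fun t ht => ?_
    split_ifs with h
    · obtain ⟨t', hn, hne⟩ := h
      have hq : parent^[m] t' ∈ (nearSet 1).erase 1 := by
        rw [mem_erase, mem_nearSet]
        refine ⟨hne, ?_⟩
        rw [← mem_desc.1 ht]
        exact near_iterate_parent m hn
      refine le_trans ?_ (single_le_sum (fun _ _ => Nat.zero_le _) hq)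
      refine le_trans ?_ (single_le_sum (fun _ _ => Nat.zero_le _) (mem_desc.2 rfl))
      rw [if_pos hn]
    · exact Nat.zero_le _
  refine h1.trans ?_
  have h2 : ∀ q ∈ (nearSet 1).erase 1, pairCount m q ≤ 36 * pairCount (m + 18) p := by
    intro q hq
    rw [mem_erase, mem_nearSet] at hq
    exact pairCount_le m hp hq.2 hq.1
  refine (sum_le_card_nsmul _ _ _ h2).trans ?_
  rw [smul_eq_mul, mul_assoc]
  exact Nat.mul_le_mul_right _ ((card_le_card (erase_subset _ _)).trans (card_nearSet_le 1))

open Classical in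
/-- The descendants of `0 → 1` after `k` refinements that are obtained by a step of `touch` from an
edge that does not descend from `0 → 1`. -/
noncomputable def inner (k : ℕ) : Finset Edge :=
  {t ∈ desc k 1 | ∃ g ∈ touch, parent^[k] (t * g⁻¹) ≠ 1}

theorem mem_inner {k : ℕ} {t : Edge} :
    t ∈ inner k ↔ parent^[k] t = 1 ∧ ∃ g ∈ touch, parent^[k] (t * g⁻¹) ≠ 1 := by
  simp [inner, mem_desc]

theorem inner_subset_bdry (k : ℕ) : inner k ⊆ bdry k 1 := by
  intro t ht
  obtain ⟨h, g, hg, hk⟩ := mem_inner.1 ht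
  refine mem_bdry.2 ⟨h, t * g⁻¹, ?_, hk⟩
  rw [← near_one_inv_mul, inv_mul_cancel_left]
  exact near_of_big (inv_mem_big_of_mem_touch g hg)

/-- A chain of edges, each obtained from its predecessor by an element of `touch`, leads from an
outer edge near `t` to `t`; it enters the descendants of the edge `0 → 1` at some point. -/
theorem exists_mem_inner_near {k : ℕ} {t : Edge} (ht : t ∈ bdry k 1) : ∃ s ∈ inner k, Near t s := by
  obtain ⟨h, t', hn, hk⟩ := mem_bdry.1 ht
  have key : ∀ n : ℕ, ∀ q : Edge, (gap q).toNat = n → Near 1 q → parent^[k] (t * q) ≠ 1 →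
      ∃ s ∈ inner k, Near t s := by
    intro n
    induction n using Nat.strong_induction_on with
    | _ n ih =>
      intro q hqn hq hk
      have hq1 : q ≠ 1 := by rintro rfl; exact hk (by rwa [mul_one])
      obtain ⟨g, hg, h1⟩ := exists_touch_of_box q (mem_box_of_near hq) (gap_le_iff.2 hq) hq1
      have hnear : Near 1 (q * g) := by
        rcases h1 with h1 | h1
        · rw [h1]; exact near_self 1
        · rw [← gap_le_iff] at hq ⊢; omega
      by_cases hin : parent^[k] (t * (q * g)) = 1
      · refine ⟨t * (q * g), mem_inner.2 ⟨hin, g, hg, ?_⟩, ?_⟩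
        · rwa [mul_assoc, mul_inv_cancel_right]
        · simpa using (near_mul_left (h := t)).2 hnear
      · rcases h1 with h1 | h1
        · rw [h1, mul_one] at hin
          exact absurd h hin
        · have h0 : 0 ≤ gap (q * g) := add_nonneg (mul_self_nonneg _) (mul_self_nonneg _)
          exact ih _ (by omega) (q * g) rfl hnear hin
  refine key _ (t⁻¹ * t') rfl (near_one_inv_mul.2 hn) ?_
  rwa [mul_inv_cancel_left]

theorem bdryCount_le_card_inner (k : ℕ) : bdryCount k ≤ 120 * (inner k).card := by
  choose! s hs using fun t (ht : t ∈ bdry k 1) => exists_mem_inner_near ht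
  refine card_le_mul_card_image_of_maps_to (f := s) (fun t ht => (hs t ht).1) _ fun u _ => ?_
  refine (card_le_card fun t ht => ?_).trans (card_nearSet_le u)
  obtain ⟨ht, hu⟩ := mem_filter.1 ht
  exact hu ▸ mem_nearSet.2 (hs t ht).2.symm

/-- Each inner edge has many descendants on the boundary. -/
theorem bdryCount_le_card_fiber (k m : ℕ) {s : Edge} (hs : s ∈ inner k) :
    bdryCount m ≤ 120 * 36 * 120 *
      ({t ∈ bdry (k + (m + 18)) 1 | parent^[m + 18] t = s} : Finset Edge).card := by
  obtain ⟨hs, g, hg, hne⟩ := mem_inner.1 hs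
  have h1 := bdryCount_le m (inv_mem_big_of_mem_touch g hg)
  have h2 := nearPairs_eq_pairCount (m + 18) s (s * g⁻¹)
  rw [inv_mul_cancel_left] at h2
  rw [mul_assoc (120 * 36)]
  refine h1.trans (Nat.mul_le_mul_left _ ?_)
  rw [← h2, nearPairs, mul_comm, ← smul_eq_mul]
  have hsub : ({t ∈ bdry (k + (m + 18)) 1 | parent^[m + 18] t = s} : Finset Edge) ⊆
      desc (m + 18) s := fun t ht => mem_desc.2 (mem_filter.1 ht).2
  rw [← sum_subset hsub]
  · refine sum_le_card_nsmul _ _ _ fun t _ => ?_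
    rw [← card_filter]
    exact (card_le_card fun t' ht' => mem_nearSet.2 (mem_filter.1 ht').2).trans (card_nearSet_le t)
  · intro t ht htn
    refine sum_eq_zero fun t' ht' => if_neg fun hn => htn ?_
    rw [mem_desc] at ht ht'
    refine mem_filter.2 ⟨mem_bdry.2 ⟨?_, t', hn, ?_⟩, ht⟩
    · rw [Function.iterate_add_apply, ht, hs]
    · rwa [Function.iterate_add_apply, ht']

/-- Supermultiplicativity up to a constant. Each of the inner edges at stage `k` has many descendants
on the boundary at stage `k + m + 18`; the superfluous `18` stages cost a constant factor. -/
theorem bdryCount_mul_le (k m : ℕ) : bdryCount k * bdryCount m ≤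
    120 * (120 * 36 * 120) * bdryCount 18 * bdryCount (k + m) := by
  have h1 := bdryCount_le_card_inner k
  have h2 : (inner k).card * bdryCount m ≤ 120 * 36 * 120 * bdryCount (k + (m + 18)) := by
    calc _ = ∑ _s ∈ inner k, bdryCount m := by rw [sum_const, smul_eq_mul]
      _ ≤ ∑ s ∈ inner k, 120 * 36 * 120 *
          ({t ∈ bdry (k + (m + 18)) 1 | parent^[m + 18] t = s} : Finset Edge).card :=
        sum_le_sum fun s hs => bdryCount_le_card_fiber k m hs
      _ ≤ _ := by
        rw [← mul_sum, sum_card_fiberwise_eq_card_filter]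
        exact Nat.mul_le_mul_left _ (card_filter_le _ _)
  have h3 := bdryCount_add_le (k + m) 18
  rw [add_assoc] at h3
  calc _ ≤ 120 * (inner k).card * bdryCount m := Nat.mul_le_mul_right _ h1
    _ = 120 * ((inner k).card * bdryCount m) := by ring
    _ ≤ 120 * (120 * 36 * 120 * (bdryCount (k + m) * bdryCount 18)) :=
      Nat.mul_le_mul_left _ (h2.trans (Nat.mul_le_mul_left _ h3))
    _ = _ := by ring

theorem one_le_bdryCount (m : ℕ) : 1 ≤ bdryCount m := by
  -- the edges from `0` in the directions `1` and `i` are their own descendants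
  have h : ∀ r : Fin 4, parent ⟨0, r⟩ = ⟨0, r⟩ := by decide
  refine card_pos.2 ⟨1, mem_bdry.2 ⟨Function.iterate_fixed (h 0) m, ⟨0, 1⟩, by decide, ?_⟩⟩
  rw [Function.iterate_fixed (h 1) m]
  decide

end Edge

end LevyDragon

/-! ### Growth rates -/

namespace LevyDragon

open Filter Topology

/-- A sequence that is submultiplicative, and supermultiplicative up to a constant factor, is
comparable to a geometric sequence. -/
theorem exists_growth_rate {u : ℕ → ℝ} {M : ℝ} (h1 : ∀ k, 1 ≤ u k)
    (hsub : ∀ k m, u (k + m) ≤ u k * u m) (hsup : ∀ k m, u k * u m ≤ M * u (k + m)) :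
    ∃ β : ℝ, 1 ≤ β ∧ ∀ k, β ^ k ≤ u k ∧ u k ≤ M * β ^ k := by
  have hpos : ∀ k, 0 < u k := fun k => one_pos.trans_le (h1 k)
  have hM : 0 < M := by
    have := hsup 0 0
    by_contra hM
    nlinarith [hpos 0, hpos (0 + 0)]
  have hlog : ∀ k, 0 ≤ Real.log (u k) := fun k => Real.log_nonneg (h1 k)
  have hS : Subadditive fun k => Real.log (u k) := fun k m => by
    rw [← Real.log_mul (hpos k).ne' (hpos m).ne']
    exact Real.log_le_log (hpos _) (hsub k m)
  have hbdd : BddBelow (Set.range fun n : ℕ => Real.log (u n) / n) :=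
    ⟨0, by rintro _ ⟨n, rfl⟩; exact div_nonneg (hlog n) n.cast_nonneg⟩
  have hlim := hS.tendsto_lim hbdd
  have h0 : 0 ≤ hS.lim := ge_of_tendsto' hlim fun n => div_nonneg (hlog n) n.cast_nonneg
  refine ⟨Real.exp hS.lim, Real.one_le_exp h0, fun k => ?_⟩
  rw [← Real.exp_nat_mul]
  rcases Nat.eq_zero_or_pos k with rfl | hk
  · have := hsup 0 0
    simp only [Nat.cast_zero, zero_mul, Real.exp_zero, mul_one, add_zero] at this ⊢
    exact ⟨h1 0, le_of_mul_le_mul_right this (hpos 0)⟩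
  have hk' : (0 : ℝ) < k := by exact_mod_cast hk
  constructor
  · rw [← Real.le_log_iff_exp_le (hpos k), mul_comm, ← le_div_iff₀ hk']
    exact hS.lim_le_div hbdd hk.ne'
  · have hpow : ∀ n : ℕ, n * Real.log (u k) ≤ n * Real.log M + Real.log (u (k * n)) := by
      intro n
      induction n with
      | zero => simpa using hlog 0
      | succ n ih =>
        have h2 := Real.log_le_log (mul_pos (hpos _) (hpos _)) (hsup (k * n) k)
        rw [Real.log_mul (hpos _).ne' (hpos _).ne', Real.log_mul hM.ne' (hpos _).ne'] at h2
        rw [Nat.mul_succ]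
        push_cast
        linarith
    have hsubseq : Tendsto (fun n : ℕ => Real.log (u (k * n)) / ((k * n : ℕ) : ℝ)) atTop
        (𝓝 hS.lim) := hlim.comp (tendsto_id.const_mul_atTop' hk)
    have h3 : Real.log (u k) / k - Real.log M / k ≤ hS.lim := by
      refine ge_of_tendsto hsubseq ?_
      filter_upwards [eventually_gt_atTop 0] with n hn
      have hn' : (0 : ℝ) < n := by exact_mod_cast hn
      rw [← sub_div, Nat.cast_mul, div_le_div_iff₀ hk' (by positivity)]
      have := mul_le_mul_of_nonneg_right (hpow n) hk'.le
      linarith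
    rw [← sub_div, div_le_iff₀ hk'] at h3
    calc u k = Real.exp (Real.log (u k)) := (Real.exp_log (hpos k)).symm
      _ ≤ Real.exp (Real.log M + k * hS.lim) := Real.exp_le_exp.2 (by linarith)
      _ = M * Real.exp (k * hS.lim) := by rw [Real.exp_add, Real.exp_log hM]

/-- Sequences that are comparable to a geometric sequence have its ratio as growth rate. -/
theorem tendsto_rpow_one_div {v : ℕ → ℝ} {β c C : ℝ} (hβ : 0 < β) (hc : 0 < c)
    (h : ∀ k, c * β ^ k ≤ v k ∧ v k ≤ C * β ^ k) :
    Tendsto (fun k : ℕ => v k ^ (1 / (k : ℝ))) atTop (𝓝 β) := by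
  have hC : 0 < C := by
    have := h 0
    simp at this
    linarith
  have key : ∀ a : ℝ, 0 < a →
      Tendsto (fun k : ℕ => (a * β ^ k) ^ (1 / (k : ℝ))) atTop (𝓝 β) := by
    intro a ha
    have h1 : Tendsto (fun k : ℕ => a ^ (1 / (k : ℝ)) * β) atTop (𝓝 (a ^ (0 : ℝ) * β)) :=
      (Tendsto.rpow tendsto_const_nhds tendsto_one_div_atTop_nhds_zero_nat
        (Or.inl ha.ne')).mul_const β
    rw [Real.rpow_zero, one_mul] at h1
    refine h1.congr' ?_
    filter_upwards [eventually_gt_atTop 0] with k hk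
    rw [Real.mul_rpow ha.le (by positivity), one_div, Real.pow_rpow_inv_natCast hβ.le hk.ne']
  refine tendsto_of_tendsto_of_tendsto_of_le_of_le (key c hc) (key C hC) (fun k => ?_) fun k => ?_
  · exact Real.rpow_le_rpow (by positivity) (h k).1 (by positivity)
  · exact Real.rpow_le_rpow (le_trans (by positivity) (h k).1) (h k).2 (by positivity)

end LevyDragon

/-! ### Tilings of the plane -/

namespace LevyDragon

open Edge Metric Filter Topology
open scoped ComplexConjugate

/-- The ratio and rotation `(1 + i) / 2` by which the lattice is refined. -/
noncomputable def θ : ℂ := (1 + Complex.I) / 2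

/-- The length of `θ`. -/
noncomputable def ρ : ℝ := (√2)⁻¹

theorem ρ_pos : 0 < ρ := by unfold ρ; positivity

theorem ρ_sq : ρ ^ 2 = 1 / 2 := by
  rw [ρ, inv_pow, Real.sq_sqrt (by norm_num)]; norm_num

theorem ρ_lt_one : ρ < 1 := by nlinarith [ρ_sq, ρ_pos]

theorem norm_θ : ‖θ‖ = ρ := by
  rw [← sq_eq_sq₀ (norm_nonneg _) ρ_pos.le, ρ_sq, Complex.sq_norm, Complex.normSq_apply]
  simp [θ]; norm_num

theorem θ_mul : θ * (1 - Complex.I) = 1 := by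
  rw [θ, div_mul_eq_mul_div, ← sq_sub_sq, Complex.I_sq]; norm_num

theorem θ_ne_zero : θ ≠ 0 := left_ne_zero_of_mul_eq_one θ_mul

/-- The similarity of the plane that carries the segment from `0` to `1` to the edge `e` of the
lattice `θ ^ k • ℤ[i]`. -/
noncomputable def place (k : ℕ) (e : Edge) (z : ℂ) : ℂ :=
  θ ^ k * (GaussianInt.toComplex e.pt + GaussianInt.toComplex (dir e.rot) * z)

theorem norm_toComplex_sq (a : GaussianInt) : ‖GaussianInt.toComplex a‖ ^ 2 = a.norm := by
  rw [Complex.sq_norm, GaussianInt.intCast_real_norm]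

theorem norm_toComplex_dir (r : Fin 4) : ‖GaussianInt.toComplex (dir r)‖ = 1 := by
  rw [← sq_eq_sq₀ (norm_nonneg _) zero_le_one, norm_toComplex_sq, norm_dir]; simp

theorem dist_place (k : ℕ) (e : Edge) (z w : ℂ) :
    dist (place k e z) (place k e w) = ρ ^ k * dist z w := by
  rw [dist_eq_norm, dist_eq_norm, place, place, ← mul_sub, add_sub_add_left_eq_sub, ← mul_sub,
    norm_mul, norm_mul, norm_pow, norm_θ, norm_toComplex_dir, one_mul]

theorem place_mul (k : ℕ) (e e' : Edge) (z : ℂ) :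
    place k (e * e') z = place k e (place 0 e' z) := by
  simp only [place, mul_pt, mul_rot, dir_add, map_add, map_mul]; ring

theorem place_one (z : ℂ) : place 0 1 z = z := by
  simp [place, one_pt, one_rot, dir_zero]

theorem place_refine (k : ℕ) (e : Edge) (z : ℂ) :
    place (k + 1) (refine e) z = place k e (θ * z) := by
  have h : GaussianInt.toComplex ⟨1, -1⟩ = 1 - Complex.I := by
    simp [GaussianInt.toComplex_def, sub_eq_add_neg]
  simp only [place, refine_pt, refine_rot, map_mul, h]
  linear_combination (θ ^ k * GaussianInt.toComplex e.pt) * θ_mul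

/-- The two similitudes in complex notation. -/
noncomputable def sim (i : Fin 2) (z : ℂ) : ℂ := place 1 (leg i) z

theorem place_child (k : ℕ) (i : Fin 2) (e : Edge) (z : ℂ) :
    place (k + 1) (child i e) z = place k e (sim i z) := by
  rw [child, place_mul, place_refine, sim]
  simp [place]

theorem sim_zero (z : ℂ) : sim 0 z = θ * z := by
  simp [sim, leg, place, one_pt, one_rot, dir_zero]

theorem sim_one (z : ℂ) : sim 1 z = θ * (1 - Complex.I * z) := by
  have h : GaussianInt.toComplex (dir 3) = -Complex.I := by
    simp [dir, GaussianInt.toComplex_def]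
  simp [sim, leg, place, h, sub_eq_add_neg]

theorem continuous_place (k : ℕ) (e : Edge) : Continuous (place k e) := by
  unfold place; fun_prop

/-- The midpoint of an edge of the lattice `θ ^ k • ℤ[i]`. -/
theorem place_half (k : ℕ) (e : Edge) :
    place k e (1 / 2) = θ ^ k * (GaussianInt.toComplex (mid e) / 2) := by
  rw [place, mid, map_add, map_mul, map_ofNat]; ring

theorem dist_place_half_sq (k : ℕ) (e e' : Edge) :
    (2 * dist (place k e (1 / 2)) (place k e' (1 / 2))) ^ 2 = (ρ ^ k) ^ 2 * sep e e' := by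
  rw [place_half, place_half, dist_comm, dist_eq_norm, ← mul_sub, ← sub_div, norm_mul, norm_pow,
    norm_θ, norm_div, ← map_sub, sep, ← norm_toComplex_sq]
  simp; ring

/-- If the midpoints of two edges are near each other, then so are the edges. -/
theorem sep_le_of_dist_le {k : ℕ} {e e' : Edge} {R : ℝ}
    (h : dist (place k e (1 / 2)) (place k e' (1 / 2)) ≤ ρ ^ k * R) :
    (sep e e' : ℝ) ≤ (2 * R) ^ 2 := by
  have h1 := dist_place_half_sq k e e'
  have hk : 0 < ρ ^ k := pow_pos ρ_pos k
  have h2 : (2 * dist (place k e (1 / 2)) (place k e' (1 / 2))) ^ 2 ≤ (2 * (ρ ^ k * R)) ^ 2 := by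
    gcongr
  rw [h1, show (2 * (ρ ^ k * R)) ^ 2 = (ρ ^ k) ^ 2 * (2 * R) ^ 2 by ring] at h2
  exact le_of_mul_le_mul_left h2 (by positivity)

/-- The copy of the set `A` that sits on an edge of the lattice `θ ^ k • ℤ[i]`. -/
def tile (A : Set ℂ) (k : ℕ) (e : Edge) : Set ℂ := place k e '' A

/-- A radius for which the disc about `1 / 2` contains the dragon. -/
noncomputable def radius : ℝ := (1 + √2) / 2

theorem sqrt_two_sq : √2 ^ 2 = 2 := Real.sq_sqrt (by norm_num)

theorem sqrt_two_bounds : 1 < √2 ∧ √2 < 1.415 := by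
  constructor
  · rw [Real.lt_sqrt] <;> norm_num
  · rw [Real.sqrt_lt'] <;> norm_num

theorem dist_le_of_mem_tile {A : Set ℂ} (hA : A ⊆ closedBall (1 / 2) radius) {k : ℕ} {e : Edge}
    {x : ℂ} (hx : x ∈ tile A k e) : dist x (place k e (1 / 2)) ≤ ρ ^ k * radius := by
  obtain ⟨z, hz, rfl⟩ := hx
  rw [dist_place]
  exact mul_le_mul_of_nonneg_left (hA hz) (pow_pos ρ_pos k).le

theorem sep_le_of_dist_le_of_mem_tile {A : Set ℂ} (hA : A ⊆ closedBall (1 / 2) radius) {k : ℕ}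
    {e e' : Edge} {x x' : ℂ} {R : ℝ} (hx : x ∈ tile A k e) (hx' : x' ∈ tile A k e')
    (h : dist x x' ≤ ρ ^ k * R) : (sep e e' : ℝ) ≤ (2 * (2 * radius + R)) ^ 2 := by
  have h1 := dist_le_of_mem_tile hA hx
  have h2 := dist_le_of_mem_tile hA hx'
  refine sep_le_of_dist_le (k := k) ?_
  rw [dist_comm] at h1
  have := dist_triangle4 (place k e (1 / 2)) x x' (place k e' (1 / 2))
  linarith

theorem near_of_mem_tile {A : Set ℂ} (hA : A ⊆ closedBall (1 / 2) radius) {k : ℕ}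
    {e e' : Edge} {x : ℂ} (hx : x ∈ tile A k e) (hx' : x ∈ tile A k e') : Near e e' := by
  have h := sep_le_of_dist_le_of_mem_tile (R := 0) hA hx hx' (by simp)
  have h2 : (sep e e' : ℝ) < 24 := by
    refine h.trans_lt ?_
    rw [radius]
    nlinarith [sqrt_two_sq, sqrt_two_bounds]
  have h3 : sep e e' < 24 := by exact_mod_cast h2
  exact Int.lt_add_one_iff.1 h3

theorem finite_sep_le_of (e : Edge) (R : ℤ) : {e' : Edge | sep e e' ≤ R}.Finite := by
  refine ((finite_sep_le R).image (e * ·)).subset fun e' he' => ⟨e⁻¹ * e', ?_, by simp⟩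
  simpa [sep_one_inv_mul] using he'

theorem locallyFinite_tile {A : Set ℂ} (hA : A ⊆ closedBall (1 / 2) radius) (k : ℕ) :
    LocallyFinite (tile A k) := by
  intro x
  refine ⟨ball x (ρ ^ k), ball_mem_nhds x (pow_pos ρ_pos k), ?_⟩
  rcases Set.eq_empty_or_nonempty {e | (tile A k e ∩ ball x (ρ ^ k)).Nonempty} with h | ⟨e, y, hy⟩
  · rw [h]; exact Set.finite_empty
  · refine (finite_sep_le_of e ⌊(2 * (2 * radius + 2)) ^ 2⌋).subset ?_
    rintro e' ⟨y', hy'⟩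
    refine Int.le_floor.2 (sep_le_of_dist_le_of_mem_tile hA hy.1 hy'.1 ?_)
    have h1 := mem_ball.1 hy.2
    have h2 := mem_ball'.1 hy'.2
    linarith [dist_triangle y x y']

/-- If `A` is the union of its images under the two similitudes, then a tile is the union of the
tiles on the descendants of its edge. -/
theorem mem_tile_iff {A : Set ℂ} (hA : A = sim 0 '' A ∪ sim 1 '' A) {k m : ℕ} {e : Edge} {x : ℂ} :
    x ∈ tile A k e ↔ ∃ t ∈ desc m e, x ∈ tile A (k + m) t := by
  induction m generalizing k e with
  | zero => simp [desc]
  | succ m ih =>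
    have h1 : x ∈ tile A k e ↔ x ∈ tile A (k + 1) (child 0 e) ∨ x ∈ tile A (k + 1) (child 1 e) := by
      have : ∀ i, place (k + 1) (child i e) '' A = place k e '' (sim i '' A) := fun i => by
        rw [Set.image_image]; simp only [place_child]
      rw [tile, tile, tile, this, this, ← Set.mem_union, ← Set.image_union, ← hA]
    rw [h1, ih, ih, desc]
    simp only [Finset.mem_union, or_and_right, exists_or, add_assoc, add_comm 1 m]

/-! ### The triangle tiling -/

/-- The triangle with vertices `0`, `(1 + i) / 2`, `1`. -/
def tri : Set ℂ := {z | 0 ≤ z.im ∧ z.im ≤ z.re ∧ z.im ≤ 1 - z.re}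

theorem tri_subset : tri ⊆ closedBall (1 / 2) radius := by
  rintro z ⟨h1, h2, h3⟩
  rw [mem_closedBall, dist_eq_norm]
  refine (Complex.norm_le_abs_re_add_abs_im _).trans ?_
  have := sqrt_two_bounds.1
  have hre : ((1 : ℂ) / 2).re = 1 / 2 := by norm_num
  have him : ((1 : ℂ) / 2).im = 0 := by norm_num
  rw [Complex.sub_re, Complex.sub_im, hre, him, sub_zero, abs_of_nonneg h1, radius]
  rcases abs_cases (z.re - 1 / 2) with h | h <;> linarith

theorem place_re_im (e : Edge) (z : ℂ) :
    (place 0 e z).re = e.pt.re + ((dir e.rot).re * z.re - (dir e.rot).im * z.im) ∧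
    (place 0 e z).im = e.pt.im + ((dir e.rot).re * z.im + (dir e.rot).im * z.re) := by
  simp only [place, pow_zero, one_mul, GaussianInt.toComplex_def, Complex.add_re, Complex.add_im,
    Complex.mul_re, Complex.mul_im, Complex.intCast_re, Complex.intCast_im, Complex.I_re,
    Complex.I_im]
  constructor <;> ring

theorem place_zero_eq (k : ℕ) (e : Edge) (z : ℂ) : place k e z = θ ^ k * place 0 e z := by
  simp only [place, pow_zero, one_mul]

/-- The triangles cover the plane. -/
theorem exists_mem_tile_tri (k : ℕ) (w : ℂ) : ∃ e, w ∈ tile tri k e := by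
  obtain ⟨w, rfl⟩ : ∃ z, w = θ ^ k * z :=
    ⟨w / θ ^ k, (mul_div_cancel₀ w (pow_ne_zero k θ_ne_zero)).symm⟩
  suffices h : ∃ e, ∃ z ∈ tri, place 0 e z = w by
    obtain ⟨e, z, hz, rfl⟩ := h
    exact ⟨e, z, hz, place_zero_eq k e z⟩
  have hx0 := Int.fract_nonneg w.re
  have hx1 := Int.fract_lt_one w.re
  have hy0 := Int.fract_nonneg w.im
  have hy1 := Int.fract_lt_one w.im
  have hx := Int.floor_add_fract w.re
  have hy := Int.floor_add_fract w.im
  set X := Int.fract w.re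
  set Y := Int.fract w.im
  rcases le_total Y X with h | h <;> rcases le_total Y (1 - X) with h' | h'
  · refine ⟨⟨⟨⌊w.re⌋, ⌊w.im⌋⟩, 0⟩, ⟨X, Y⟩, ⟨hy0, h, h'⟩, ?_⟩
    apply Complex.ext <;> simp [place_re_im, dir] <;> linarith
  · refine ⟨⟨⟨⌊w.re⌋ + 1, ⌊w.im⌋⟩, 1⟩, ⟨Y, 1 - X⟩, ⟨?_, ?_, ?_⟩, ?_⟩ <;>
      try { dsimp only; linarith }
    apply Complex.ext <;> simp [place_re_im, dir] <;> linarith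
  · refine ⟨⟨⟨⌊w.re⌋, ⌊w.im⌋ + 1⟩, 3⟩, ⟨1 - Y, X⟩, ⟨?_, ?_, ?_⟩, ?_⟩ <;>
      try { dsimp only; linarith }
    apply Complex.ext <;> simp [place_re_im, dir] <;> linarith
  · refine ⟨⟨⟨⌊w.re⌋ + 1, ⌊w.im⌋ + 1⟩, 2⟩, ⟨1 - X, 1 - Y⟩, ⟨?_, ?_, ?_⟩, ?_⟩ <;>
      try { dsimp only; linarith }
    apply Complex.ext <;> simp [place_re_im, dir] <;> linarith

/-- The open triangle does not meet the other triangles of the tiling. -/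
theorem eq_one_of_place_mem_tri {q : Edge} {z : ℂ} (h1 : 0 < z.im) (h2 : z.im < z.re)
    (h3 : z.im < 1 - z.re) (h : place 0 q z ∈ tri) : q = 1 := by
  obtain ⟨⟨a, b⟩, r⟩ := q
  obtain ⟨g1, g2, g3⟩ := h
  simp only [place_re_im] at g1 g2 g3
  fin_cases r <;> simp [dir] at g1 g2 g3
  · have ha1 : a < 1 := by exact_mod_cast (by linarith : (a : ℝ) < 1)
    have ha2 : -1 < a := by exact_mod_cast (by linarith : (-1 : ℝ) < a)
    have hb1 : b < 1 := by exact_mod_cast (by linarith : (b : ℝ) < 1)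
    have hb2 : -1 < b := by exact_mod_cast (by linarith : (-1 : ℝ) < b)
    obtain rfl : a = 0 := by omega
    obtain rfl : b = 0 := by omega
    rfl
  · have ha1 : a < 2 := by exact_mod_cast (by linarith : (a : ℝ) < 2)
    have ha2 : 0 < a := by exact_mod_cast (by linarith : (0 : ℝ) < a)
    have hb1 : b < 1 := by exact_mod_cast (by linarith : (b : ℝ) < 1)
    have hb2 : -1 < b := by exact_mod_cast (by linarith : (-1 : ℝ) < b)
    obtain rfl : a = 1 := by omega
    obtain rfl : b = 0 := by omega
    norm_num at g1 g2 g3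
    linarith
  · have hb1 : b < 1 := by exact_mod_cast (by linarith : (b : ℝ) < 1)
    have hb2 : 0 < b := by exact_mod_cast (by linarith : (0 : ℝ) < b)
    omega
  · have ha1 : a < 1 := by exact_mod_cast (by linarith : (a : ℝ) < 1)
    have ha2 : -1 < a := by exact_mod_cast (by linarith : (-1 : ℝ) < a)
    have hb1 : b < 2 := by exact_mod_cast (by linarith : (b : ℝ) < 2)
    have hb2 : 0 < b := by exact_mod_cast (by linarith : (0 : ℝ) < b)
    obtain rfl : a = 0 := by omega
    obtain rfl : b = 1 := by omega
    norm_num at g1 g2 g3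
    linarith

end LevyDragon

/-! ### The dragon and its boundary -/

namespace LevyDragon

open Edge Metric Filter Topology

/-- The identification of the complex numbers with the Euclidean plane. -/
noncomputable def toPlane : ℂ ≃ₗᵢ[ℝ] Plane := Complex.orthonormalBasisOneI.repr

theorem toPlane_apply (z : ℂ) : toPlane z = !₂[z.re, z.im] := by
  ext i
  fin_cases i <;> simp [toPlane]

theorem f_toPlane (i : Fin 2) (z : ℂ) : f i (toPlane z) = toPlane (sim i z) := by
  ext j
  fin_cases i <;> fin_cases j <;>
    simp [toPlane_apply, f, sim_zero, sim_one, θ] <;> ring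

/-- The dragon as a set of complex numbers. -/
def D : Set ℂ := toPlane ⁻¹' K

theorem D_eq_image : D = toPlane.symm '' K := (toPlane.toEquiv.image_symm_eq_preimage K).symm

theorem isCompact_D : IsCompact D := by
  rw [D_eq_image]
  exact ((eq_K_iff K).1 rfl).2.1.image toPlane.symm.continuous

theorem nonempty_D : D.Nonempty := by
  rw [D_eq_image]
  exact ((eq_K_iff K).1 rfl).1.image _

theorem preimage_image_f (i : Fin 2) (A : Set Plane) :
    toPlane ⁻¹' (f i '' A) = sim i '' (toPlane ⁻¹' A) := by
  ext z
  constructor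
  · rintro ⟨p, hp, hz⟩
    obtain ⟨w, rfl⟩ := toPlane.surjective p
    rw [f_toPlane] at hz
    exact ⟨w, hp, toPlane.injective hz⟩
  · rintro ⟨w, hw, rfl⟩
    exact ⟨toPlane w, hw, f_toPlane i w⟩

theorem D_eq : D = sim 0 '' D ∪ sim 1 '' D := by
  have h := ((eq_K_iff K).1 rfl).2.2
  conv_lhs => rw [D, h, F, Set.preimage_union, preimage_image_f, preimage_image_f]
  rfl

theorem sim_mem_D (i : Fin 2) {z : ℂ} (hz : z ∈ D) : sim i z ∈ D := by
  rw [D_eq]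
  fin_cases i
  · exact Or.inl ⟨z, hz, rfl⟩
  · exact Or.inr ⟨z, hz, rfl⟩

theorem dist_sim (i : Fin 2) (z w : ℂ) : dist (sim i z) (sim i w) = ρ * dist z w := by
  rw [sim, sim, dist_place, pow_one]

theorem dist_sim_half (i : Fin 2) : dist (sim i (1 / 2)) (1 / 2) = ρ / 2 := by
  have h2 : dist (sim i (1 / 2)) (1 / 2) ^ 2 = (ρ / 2) ^ 2 := by
    rw [div_pow, ρ_sq, dist_eq_norm, Complex.sq_norm, Complex.normSq_apply]
    fin_cases i <;> simp [sim_zero, sim_one, θ] <;> norm_num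
  exact (sq_eq_sq₀ dist_nonneg (by linarith [ρ_pos])).1 h2

theorem D_subset : D ⊆ closedBall (1 / 2) radius := by
  obtain ⟨x, hx, hmax⟩ := isCompact_D.exists_isMaxOn nonempty_D
    (f := fun z => dist z (1 / 2)) (by fun_prop)
  have key : ∃ i, ∃ y ∈ D, sim i y = x := by
    rw [D_eq] at hx
    rcases hx with ⟨y, hy, h⟩ | ⟨y, hy, h⟩
    · exact ⟨0, y, hy, h⟩
    · exact ⟨1, y, hy, h⟩
  obtain ⟨i, y, hy, rfl⟩ := key
  have h1 : dist y (1 / 2) ≤ dist (sim i y) (1 / 2) := hmax hy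
  have h2 : dist (sim i y) (1 / 2) ≤ ρ * dist y (1 / 2) + ρ / 2 := by
    rw [← dist_sim, ← dist_sim_half i]
    exact dist_triangle _ _ _
  have h3 : dist (sim i y) (1 / 2) ≤ radius := by
    have h4 : √2 * ρ = 1 := mul_inv_cancel₀ (by positivity)
    have h5 : ρ * dist y (1 / 2) ≤ ρ * dist (sim i y) (1 / 2) :=
      mul_le_mul_of_nonneg_left h1 ρ_pos.le
    set M := dist (sim i y) (1 / 2)
    have h6 : √2 * M ≤ M + 1 / 2 := by
      have := mul_le_mul_of_nonneg_left (h2.trans (add_le_add_left h5 _)) (Real.sqrt_nonneg 2)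
      calc √2 * M ≤ √2 * (ρ * M + ρ / 2) := this
        _ = (√2 * ρ) * (M + 1 / 2) := by ring
        _ = M + 1 / 2 := by rw [h4, one_mul]
    rw [radius]
    nlinarith [sqrt_two_sq, sqrt_two_bounds]
  exact fun z hz => mem_closedBall.2 ((hmax hz).trans h3)

/-- The dragon contains the fixed points of the similitudes. -/
theorem mem_D_of_fixed {i : Fin 2} {p : ℂ} (hp : sim i p = p) : p ∈ D := by
  obtain ⟨x, hx⟩ := nonempty_D
  have h1 : ∀ n, (sim i)^[n] x ∈ D ∧ dist ((sim i)^[n] x) p = ρ ^ n * dist x p := by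
    intro n
    induction n with
    | zero => simpa using hx
    | succ n ih =>
      rw [Function.iterate_succ_apply']
      refine ⟨sim_mem_D i ih.1, ?_⟩
      conv_lhs => rw [← hp]
      rw [dist_sim, ih.2]; ring
  refine isCompact_D.isClosed.mem_of_tendsto (f := fun n => (sim i)^[n] x) (b := atTop) ?_
    (Eventually.of_forall fun n => (h1 n).1)
  rw [tendsto_iff_dist_tendsto_zero]
  simp only [(h1 _).2]
  simpa using (tendsto_pow_atTop_nhds_zero_of_lt_one ρ_pos.le ρ_lt_one).mul_const (dist x p)

theorem zero_mem_D : (0 : ℂ) ∈ D := mem_D_of_fixed (i := 0) (by rw [sim_zero, mul_zero])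

theorem one_mem_D : (1 : ℂ) ∈ D := mem_D_of_fixed (i := 1) (by rw [sim_one, mul_one, θ_mul])

/-- The copies of the dragon cover the plane. -/
theorem exists_mem_tile_D (w : ℂ) : ∃ e, w ∈ tile D 0 e := by
  have hcl : IsClosed (⋃ e, tile D 0 e) :=
    (locallyFinite_tile D_subset 0).isClosed_iUnion fun e =>
      (isCompact_D.image (continuous_place 0 e)).isClosed
  rw [← Set.mem_iUnion, ← hcl.closure_eq, Metric.mem_closure_iff]
  intro ε hε
  obtain ⟨k, hk⟩ := exists_pow_lt_of_lt_one hε ρ_lt_one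
  obtain ⟨e, z, hz, rfl⟩ := exists_mem_tile_tri k w
  refine ⟨place k e 0, Set.mem_iUnion.2 ⟨parent^[k] e, ?_⟩, ?_⟩
  · refine (mem_tile_iff D_eq (m := k)).2 ⟨e, mem_desc.2 rfl, ?_⟩
    rw [zero_add]
    exact ⟨0, zero_mem_D, rfl⟩
  · rw [dist_place]
    refine lt_of_le_of_lt (mul_le_of_le_one_right (pow_pos ρ_pos k).le ?_) hk
    obtain ⟨h1, h2, h3⟩ := hz
    rw [dist_zero_right, ← sq_le_one_iff₀ (norm_nonneg _), Complex.sq_norm, Complex.normSq_apply]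
    nlinarith

theorem tile_one (A : Set ℂ) : tile A 0 1 = A := by
  have : place 0 1 = id := funext place_one
  rw [tile, this, Set.image_id]

theorem iterate_parent_foldl (L : List (Fin 2)) (e q : Edge) :
    parent^[L.length] (L.foldl (fun e i => child i e) e * q) =
      e * L.foldr (fun i q => parent (leg i * q)) q := by
  induction L generalizing e with
  | nil => rfl
  | cons a L ih =>
    rw [List.length_cons, Function.iterate_succ_apply', List.foldl_cons, ih, List.foldr_cons, child,
      mul_assoc, parent_refine_mul]

/-- There is a descendant of the edge `0 → 1` such that all edges near it descend from the
edge `0 → 1`. Its dragon lies in the interior of the dragon. -/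
theorem exists_core : ∃ (n : ℕ) (c : Edge), ∀ s, Near c s → parent^[n] s = 1 := by
  refine ⟨19, [0, 1, 0, 1, 1, 1, 0, 1, 0, 1, 0, 1, 1, 0, 1, 1, 0, 1, 1].foldl
    (fun e i => child i e) 1, fun s hs => ?_⟩
  rw [← near_one_inv_mul] at hs
  have h := core_of_box _ (mem_box_of_near hs) (gap_le_iff.2 hs)
  have h2 := iterate_parent_foldl [0, 1, 0, 1, 1, 1, 0, 1, 0, 1, 0, 1, 1, 0, 1, 1, 0, 1, 1] 1
  rw [← mul_inv_cancel_left (List.foldl (fun e i => child i e) 1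
    [0, 1, 0, 1, 1, 1, 0, 1, 0, 1, 0, 1, 1, 0, 1, 1, 0, 1, 1]) s]
  refine (h2 _).trans ?_
  rw [h, mul_one]

/-- The interior of the dragon does not meet the copies of the dragon on other edges. -/
theorem not_mem_interior_D {e : Edge} (he : e ≠ 1) {x : ℂ} (hx : x ∈ tile D 0 e) :
    x ∉ interior D := by
  intro hi
  obtain ⟨ε, hε, hball⟩ := Metric.isOpen_iff.1 isOpen_interior x hi
  have hr : 0 < 2 * radius := by unfold radius; positivity
  obtain ⟨m, hm⟩ := exists_pow_lt_of_lt_one (div_pos hε hr) ρ_lt_one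
  rw [lt_div_iff₀ hr] at hm
  obtain ⟨t, ht, hxt⟩ := (mem_tile_iff D_eq (m := m)).1 hx
  rw [zero_add] at hxt
  -- the whole tile on `t` lies in the dragon, and its core is not near the descendants of `1`
  have hsub : tile D m t ⊆ D := by
    intro y hy
    refine interior_subset (hball ?_)
    have h1 := dist_le_of_mem_tile D_subset hxt
    have h2 := dist_le_of_mem_tile D_subset hy
    rw [mem_ball]
    linarith [dist_triangle_right y x (place m t (1 / 2))]
  obtain ⟨n, c, hc⟩ := exists_core
  have hy : place (m + n) (refine^[n] t * c) 0 ∈ tile D (m + n) (refine^[n] t * c) :=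
    ⟨0, zero_mem_D, rfl⟩
  have hyt : place (m + n) (refine^[n] t * c) 0 ∈ tile D m t := by
    refine (mem_tile_iff D_eq (m := n)).2 ⟨_, ?_, hy⟩
    rw [mem_desc, iterate_parent_refine_mul n, hc c (near_self c), mul_one]
  have hyD := hsub hyt
  rw [← tile_one D, mem_tile_iff D_eq (m := m + n), zero_add] at hyD
  obtain ⟨s, hs, hys⟩ := hyD
  have hnear := near_of_mem_tile D_subset hy hys
  rw [mem_desc] at hs ht
  rw [← mul_inv_cancel_left (refine^[n] t) s, near_mul_left] at hnear
  have h1 := iterate_parent_refine_mul n t ((refine^[n] t)⁻¹ * s)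
  rw [mul_inv_cancel_left, hc _ hnear, mul_one] at h1
  rw [Function.iterate_add_apply, h1, ht] at hs
  exact he hs

/-- The boundary of the dragon consists of its points in copies of the dragon on other edges. -/
theorem mem_frontier_D {x : ℂ} : x ∈ frontier D ↔ x ∈ D ∧ ∃ e ≠ 1, x ∈ tile D 0 e := by
  rw [isCompact_D.isClosed.frontier_eq]
  refine ⟨fun ⟨hx, hxi⟩ => ⟨hx, ?_⟩, fun ⟨hx, e, he, hxe⟩ => ⟨hx, not_mem_interior_D he hxe⟩⟩
  by_contra! hne
  have hcl : IsClosed (⋃ e : {e : Edge // e ≠ 1}, tile D 0 e) :=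
    ((locallyFinite_tile D_subset 0).comp_injective Subtype.val_injective).isClosed_iUnion
      fun e => (isCompact_D.image (continuous_place 0 e)).isClosed
  refine hxi (mem_interior.2 ⟨_, fun y hy => ?_, hcl.isOpen_compl, ?_⟩)
  · obtain ⟨e, he⟩ := exists_mem_tile_D y
    by_cases h1 : e = 1
    · rwa [h1, tile_one] at he
    · exact absurd (Set.mem_iUnion.2 ⟨⟨e, h1⟩, he⟩) hy
  · rw [Set.mem_compl_iff, Set.mem_iUnion]
    rintro ⟨⟨e, he⟩, hxe⟩
    exact hne e he hxe

/-- The boundary of the dragon is covered by the tiles on the boundary edges. -/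
theorem exists_mem_bdry_of_mem_frontier_D (k : ℕ) {x : ℂ} (hx : x ∈ frontier D) :
    ∃ t ∈ bdry k 1, x ∈ tile D k t := by
  obtain ⟨hx, e, he, hxe⟩ := mem_frontier_D.1 hx
  rw [← tile_one D, mem_tile_iff D_eq (m := k), zero_add] at hx
  rw [mem_tile_iff D_eq (m := k), zero_add] at hxe
  obtain ⟨t, ht, hxt⟩ := hx
  obtain ⟨t', ht', hxt'⟩ := hxe
  rw [mem_desc] at ht ht'
  exact ⟨t, mem_bdry.2 ⟨ht, t', near_of_mem_tile D_subset hxt hxt', ht' ▸ he⟩, hxt⟩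

/-- An edge shares its initial point with each edge from which it is obtained by a step of
`touch`. -/
theorem place_touch {g : Edge} (hg : g ∈ touch) (k : ℕ) (t : Edge) :
    ∃ z, (z = 0 ∨ z = 1) ∧ place k t 0 = place k (t * g⁻¹) z := by
  have h : g.pt = 0 ∨ g.pt = 1 := by
    revert g; decide
  have h2 : place k t 0 = place k (t * g⁻¹) (GaussianInt.toComplex g.pt) := by
    conv_lhs => rw [← inv_mul_cancel_right t g, place_mul]
    simp [place]
  rcases h with h | h <;> rw [h] at h2
  · exact ⟨0, Or.inl rfl, by simpa using h2⟩
  · exact ⟨1, Or.inr rfl, by simpa using h2⟩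

/-- The common end points of inner and outer edges lie on the boundary of the dragon. -/
theorem place_mem_frontier_D {k : ℕ} {t : Edge} (ht : t ∈ inner k) :
    place k t 0 ∈ frontier D := by
  obtain ⟨ht, g, hg, hne⟩ := mem_inner.1 ht
  refine mem_frontier_D.2 ⟨?_, _, hne, ?_⟩
  · rw [← tile_one D, mem_tile_iff D_eq (m := k), zero_add]
    exact ⟨t, mem_desc.2 ht, 0, zero_mem_D, rfl⟩
  · rw [mem_tile_iff D_eq (m := k), zero_add]
    obtain ⟨z, hz, h⟩ := place_touch hg k t
    refine ⟨_, mem_desc.2 rfl, z, ?_, h.symm⟩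
    rcases hz with rfl | rfl
    · exact zero_mem_D
    · exact one_mem_D

end LevyDragon

/-! ### Words and the sets `B k` -/

namespace LevyDragon

open Edge Metric Filter Topology

theorem T₀_eq : T₀ = {p | 0 ≤ p 1 ∧ p 1 ≤ p 0 ∧ p 1 ≤ 1 - p 0} := by
  apply Set.Subset.antisymm
  · refine convexHull_min ?_ ?_
    · rintro p (rfl | rfl | rfl) <;> norm_num
    · rintro p ⟨h1, h2, h3⟩ q ⟨h1', h2', h3'⟩ a b ha hb hab
      obtain rfl : b = 1 - a := by linarith
      simp only [Set.mem_ofPred_eq, PiLp.add_apply, PiLp.smul_apply, smul_eq_mul]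
      exact ⟨by nlinarith, by nlinarith, by nlinarith⟩
  · rintro p ⟨h1, h2, h3⟩
    have hmem : ∀ i, (![!₂[0, 0], !₂[1 / 2, 1 / 2], !₂[1, 0]] : Fin 3 → Plane) i ∈ T₀ := by
      intro i
      apply subset_convexHull
      fin_cases i <;> simp
    have h := (convex_convexHull ℝ _).sum_mem (t := Finset.univ)
      (w := ![1 - p 0 - p 1, 2 * p 1, p 0 - p 1]) (fun i _ => ?_) ?_ (fun i _ => hmem i)
    · rw [T₀]
      convert h using 1
      ext j
      fin_cases j <;> simp [Fin.sum_univ_three] <;> ring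
    · fin_cases i <;> simp <;> linarith
    · simp [Fin.sum_univ_three]; ring

theorem preimage_T₀ : toPlane ⁻¹' T₀ = tri := by
  ext z
  simp [T₀_eq, toPlane_apply, tri]

/-- The tiles on the descendants of an edge form the image of an iterate of `F`. -/
theorem image_place_preimage_iterate_F (A : Set Plane) (k m : ℕ) (e : Edge) :
    place m e '' (toPlane ⁻¹' (F^[k] A)) = ⋃ t ∈ desc k e, tile (toPlane ⁻¹' A) (m + k) t := by
  induction k generalizing m e with
  | zero => simp [desc, tile]
  | succ k ih =>
    have h (i) (X : Set ℂ) : place m e '' (sim i '' X) = place (m + 1) (child i e) '' X := by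
      rw [Set.image_image]; simp only [place_child]
    rw [Function.iterate_succ_apply', F, Set.preimage_union, preimage_image_f, preimage_image_f,
      Set.image_union, h, h, ih, ih, desc, Finset.set_biUnion_union, add_assoc, add_comm 1 k]

theorem preimage_iterate_F (k : ℕ) :
    toPlane ⁻¹' (F^[k] T₀) = ⋃ t ∈ desc k 1, tile tri k t := by
  have h := image_place_preimage_iterate_F T₀ k 0 1
  rwa [← tile, tile_one, preimage_T₀, zero_add] at h

/-- The edge of the lattice `θ ^ k • ℤ[i]` that belongs to a word of length `k`. -/
def wordEdge {k : ℕ} (I : Fin k → Fin 2) : Edge :=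
  (List.ofFn I).foldl (fun e i => child i e) 1

theorem foldl_child_injective {L L' : List (Fin 2)} {e e' : Edge} (hl : L.length = L'.length)
    (h : L.foldl (fun e i => child i e) e = L'.foldl (fun e i => child i e) e') :
    L = L' ∧ e = e' := by
  induction L generalizing L' e e' with
  | nil =>
    obtain rfl := List.length_eq_zero_iff.1 hl.symm
    exact ⟨rfl, h⟩
  | cons a L ih =>
    obtain _ | ⟨a', L'⟩ := L'
    · simp at hl
    · obtain ⟨rfl, h2⟩ := ih (L' := L') (e := child a e) (e' := child a' e') (by simpa using hl) h
      have h3 := congrArg letter h2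
      have h4 := congrArg parent h2
      rw [letter_child, letter_child] at h3
      rw [parent_child, parent_child] at h4
      exact ⟨by rw [h3], h4⟩

theorem wordEdge_injective (k : ℕ) :
    Function.Injective (wordEdge : (Fin k → Fin 2) → Edge) := fun I J h =>
  List.ofFn_injective (foldl_child_injective (by simp) h).1

theorem exists_foldl_child {k : ℕ} {e t : Edge} (ht : t ∈ desc k e) :
    ∃ L : List (Fin 2), L.length = k ∧ L.foldl (fun e i => child i e) e = t := by
  induction k generalizing e with
  | zero => exact ⟨[], rfl, (Finset.mem_singleton.1 ht).symm⟩
  | succ k ih =>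
    rcases Finset.mem_union.1 ht with ht | ht
    · obtain ⟨L, hL, h⟩ := ih ht
      exact ⟨0 :: L, by simp [hL], h⟩
    · obtain ⟨L, hL, h⟩ := ih ht
      exact ⟨1 :: L, by simp [hL], h⟩

theorem exists_wordEdge {k : ℕ} {t : Edge} (ht : t ∈ desc k 1) :
    ∃ I : Fin k → Fin 2, wordEdge I = t := by
  obtain ⟨L, rfl, h⟩ := exists_foldl_child ht
  exact ⟨L.get, by rw [wordEdge, List.ofFn_get, h]⟩

theorem wordEdge_mem_desc {k : ℕ} (I : Fin k → Fin 2) : wordEdge I ∈ desc k 1 := by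
  have key : ∀ (L : List (Fin 2)) (e : Edge),
      L.foldl (fun e i => child i e) e ∈ desc L.length e := by
    intro L
    induction L with
    | nil => simp [desc]
    | cons a L ih =>
      intro e
      refine Finset.mem_union.2 ?_
      fin_cases a
      · exact Or.inl (ih _)
      · exact Or.inr (ih _)
  simpa [wordEdge] using key (List.ofFn I) 1

theorem place_foldr_sim (L : List (Fin 2)) (k : ℕ) (e : Edge) (z : ℂ) :
    place k e (L.foldr sim z) = place (k + L.length) (L.foldl (fun e i => child i e) e) z := by
  induction L generalizing k e with
  | nil => rfl
  | cons a L ih =>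
    rw [List.foldr_cons, ← place_child, ih, List.foldl_cons, List.length_cons, add_assoc,
      add_comm 1]

theorem fWord_toPlane {k : ℕ} (I : Fin k → Fin 2) (z : ℂ) :
    fWord I (toPlane z) = toPlane (place k (wordEdge I) z) := by
  have h1 : ∀ L : List (Fin 2), L.foldr f (toPlane z) = toPlane (L.foldr sim z) := by
    intro L
    induction L with
    | nil => rfl
    | cons a L ih => rw [List.foldr_cons, ih, f_toPlane, List.foldr_cons]
  have h2 := place_foldr_sim (List.ofFn I) 0 1 z
  rw [place_one, zero_add, List.length_ofFn] at h2
  rw [fWord, h1, h2, wordEdge]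

theorem preimage_fWord {k : ℕ} (I : Fin k → Fin 2) :
    toPlane ⁻¹' (fWord I '' T₀) = tile tri k (wordEdge I) := by
  rw [tile, ← preimage_T₀]
  ext z
  constructor
  · rintro ⟨p, hp, hz⟩
    obtain ⟨w, rfl⟩ := toPlane.surjective p
    rw [fWord_toPlane] at hz
    exact ⟨w, hp, toPlane.injective hz⟩
  · rintro ⟨w, hw, rfl⟩
    exact ⟨toPlane w, hw, fWord_toPlane I w⟩

theorem mem_B_iff {k : ℕ} {I : Fin k → Fin 2} : I ∈ B k ↔
    (tile tri k (wordEdge I) ∩ frontier (⋃ t ∈ desc k 1, tile tri k t)).Nonempty := by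
  rw [← preimage_fWord, ← preimage_iterate_F]
  have h : frontier (toPlane ⁻¹' (F^[k] T₀)) = toPlane ⁻¹' frontier (F^[k] T₀) :=
    (toPlane.toHomeomorph.preimage_frontier _).symm
  rw [h, ← Set.preimage_inter, B, Set.mem_ofPred_eq]
  refine ⟨fun ⟨p, hp⟩ => ⟨toPlane.symm p, by simpa using hp⟩, fun ⟨z, hz⟩ => ⟨toPlane z, hz⟩⟩

theorem isCompact_tri : IsCompact tri := by
  refine (isCompact_closedBall _ _).of_isClosed_subset ?_ tri_subset
  exact (isClosed_le continuous_const Complex.continuous_im).inter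
    ((isClosed_le Complex.continuous_im Complex.continuous_re).inter
      (isClosed_le Complex.continuous_im (continuous_const.sub Complex.continuous_re)))

/-- A triangle that meets the boundary of the union of the descendant triangles meets another
triangle of the tiling, which does not belong to the union. -/
theorem wordEdge_mem_bdry {k : ℕ} {I : Fin k → Fin 2} (hI : I ∈ B k) : wordEdge I ∈ bdry k 1 := by
  obtain ⟨x, hx, hxf⟩ := mem_B_iff.1 hI
  rw [frontier_eq_closure_inter_closure] at hxf
  have hcl : IsClosed (⋃ e : {e : Edge // e ∉ desc k 1}, tile tri k e) :=
    ((locallyFinite_tile tri_subset k).comp_injective Subtype.val_injective).isClosed_iUnion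
      fun e => (isCompact_tri.image (continuous_place k e)).isClosed
  have hsub : (⋃ t ∈ desc k 1, tile tri k t)ᶜ ⊆ ⋃ e : {e : Edge // e ∉ desc k 1}, tile tri k e := by
    intro y hy
    obtain ⟨e, he⟩ := exists_mem_tile_tri k y
    refine Set.mem_iUnion.2 ⟨⟨e, fun hd => hy ?_⟩, he⟩
    exact Set.mem_iUnion₂.2 ⟨e, hd, he⟩
  obtain ⟨⟨e, he⟩, hxe⟩ := Set.mem_iUnion.1 (closure_minimal hsub hcl hxf.2)
  rw [mem_desc] at he
  exact mem_bdry.2 ⟨mem_desc.1 (wordEdge_mem_desc I), e, near_of_mem_tile tri_subset hx hxe, he⟩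

/-- Distinct triangles of the tiling have disjoint interiors. -/
theorem eq_of_place_mem_tile_tri {k : ℕ} {e e' : Edge} {z : ℂ} (h1 : 0 < z.im) (h2 : z.im < z.re)
    (h3 : z.im < 1 - z.re) (h : place k e z ∈ tile tri k e') : e = e' := by
  obtain ⟨w, hw, h⟩ := h
  have h4 : place 0 (e'⁻¹ * e) z = w := by
    have h5 : place k e' (place 0 (e'⁻¹ * e) z) = place k e' w := by
      rw [← place_mul, mul_inv_cancel_left, h]
    have h6 := dist_place k e' (place 0 (e'⁻¹ * e) z) w
    rw [h5, dist_self, eq_comm, mul_eq_zero, dist_eq_zero] at h6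
    exact h6.resolve_left (pow_pos ρ_pos k).ne'
  exact (inv_mul_eq_one.1 (eq_one_of_place_mem_tri h1 h2 h3 (h4 ▸ hw))).symm

theorem mem_B_of_mem_inner {k : ℕ} {I : Fin k → Fin 2} (hI : wordEdge I ∈ inner k) : I ∈ B k := by
  obtain ⟨ht, g, hg, hne⟩ := mem_inner.1 hI
  obtain ⟨z, hz, h⟩ := place_touch hg k (wordEdge I)
  have hx : place k (wordEdge I) 0 ∈ tile tri k (wordEdge I) := ⟨0, by simp [tri], rfl⟩
  refine mem_B_iff.2 ⟨_, hx, ?_⟩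
  rw [frontier_eq_closure_inter_closure]
  refine ⟨subset_closure (Set.mem_iUnion₂.2 ⟨_, wordEdge_mem_desc I, hx⟩), ?_⟩
  -- approach the common end point through the interior of the outer triangle
  rw [h]
  set t' := wordEdge I * g⁻¹
  have hlim : Tendsto (fun s : ℝ => place k t' (z + s * (⟨1 / 2, 1 / 4⟩ - z))) (𝓝[>] 0)
      (𝓝 (place k t' z)) := by
    have hc : Continuous fun s : ℝ => place k t' (z + s * (⟨1 / 2, 1 / 4⟩ - z)) :=
      (continuous_place k t').comp (by fun_prop)
    have := hc.tendsto 0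
    simp only [Complex.ofReal_zero, zero_mul, add_zero] at this
    exact this.mono_left nhdsWithin_le_nhds
  refine mem_closure_of_tendsto hlim ?_
  filter_upwards [Ioo_mem_nhdsGT one_pos] with s ⟨hs0, hs1⟩ hmem
  obtain ⟨e, he, hmem⟩ := Set.mem_iUnion₂.1 hmem
  have hte : t' = e := by
    refine eq_of_place_mem_tile_tri ?_ ?_ ?_ hmem <;> rcases hz with rfl | rfl <;> simp <;> linarith
  exact hne (mem_desc.1 (hte ▸ he))

theorem card_inner_le_ncard_B (k : ℕ) : (inner k).card ≤ (B k).ncard := by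
  rw [← Set.ncard_image_of_injective (B k) (wordEdge_injective k), ← Set.ncard_coe_finset]
  refine Set.ncard_le_ncard (fun t ht => ?_) ((B k).toFinite.image _)
  obtain ⟨I, rfl⟩ := exists_wordEdge (mem_desc.2 (mem_inner.1 ht).1)
  exact ⟨I, mem_B_of_mem_inner ht, rfl⟩

theorem ncard_B_le_bdryCount (k : ℕ) : (B k).ncard ≤ bdryCount k := by
  rw [← Set.ncard_image_of_injective (B k) (wordEdge_injective k), bdryCount,
    ← Set.ncard_coe_finset]
  refine Set.ncard_le_ncard ?_ (Finset.finite_toSet _)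
  rintro _ ⟨I, hI, rfl⟩
  exact wordEdge_mem_bdry hI

end LevyDragon

/-! ### The Hausdorff measure of the boundary -/

namespace LevyDragon

open Edge Metric Filter Topology MeasureTheory
open scoped ENNReal NNReal

/-- The exponent that belongs to the growth rate `β`. -/
noncomputable def expo (β : ℝ) : ℝ := Real.log β / Real.log √2

theorem log_sqrt_two_pos : 0 < Real.log √2 := Real.log_pos sqrt_two_bounds.1

theorem expo_nonneg {β : ℝ} (hβ : 1 ≤ β) : 0 ≤ expo β :=
  div_nonneg (Real.log_nonneg hβ) log_sqrt_two_pos.le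

theorem ρ_pow_rpow_expo {β : ℝ} (hβ : 1 ≤ β) (k : ℕ) : (ρ ^ k) ^ expo β = (β ^ k)⁻¹ := by
  have h : ρ ^ expo β = β⁻¹ := by
    rw [ρ, Real.inv_rpow (Real.sqrt_nonneg 2), Real.rpow_def_of_pos (by positivity), expo,
      mul_div_cancel₀ _ log_sqrt_two_pos.ne', Real.exp_log (by linarith)]
  rw [← Real.rpow_natCast, ← Real.rpow_mul ρ_pos.le, mul_comm, Real.rpow_mul ρ_pos.le, h,
    Real.rpow_natCast, inv_pow]

theorem radius_pos : 0 < radius := by unfold radius; positivity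

theorem ediam_tile_le (k : ℕ) (e : Edge) :
    ediam (tile D k e) ≤ ENNReal.ofReal (2 * radius * ρ ^ k) := by
  refine ediam_le fun x hx y hy => ?_
  rw [edist_dist]
  refine ENNReal.ofReal_le_ofReal ?_
  have h1 := dist_le_of_mem_tile D_subset hx
  have h2 := dist_le_of_mem_tile D_subset hy
  linarith [dist_triangle_right x y (place k e (1 / 2))]

/-- The tiles on the boundary edges give coverings that bound the Hausdorff measure from above. -/
theorem hausdorffMeasure_frontier_D_lt_top {β M : ℝ} (hβ : 1 ≤ β)
    (hM : ∀ k, (bdryCount k : ℝ) ≤ M * β ^ k) : μH[expo β] (frontier D) < ⊤ := by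
  have hr : Tendsto (fun k : ℕ => ENNReal.ofReal (2 * radius * ρ ^ k)) atTop (𝓝 0) := by
    rw [← ENNReal.ofReal_zero]
    refine ENNReal.tendsto_ofReal ?_
    simpa using (tendsto_pow_atTop_nhds_zero_of_lt_one ρ_pos.le ρ_lt_one).const_mul (2 * radius)
  refine lt_of_le_of_lt (Measure.hausdorffMeasure_le_liminf_sum (ι := fun k => bdry k 1) _ _ _ hr
    (fun k t => tile D k t) (Eventually.of_forall fun k t => ediam_tile_le k t)
    (Eventually.of_forall fun k x hx => ?_)) ?_
  · obtain ⟨t, ht, hxt⟩ := exists_mem_bdry_of_mem_frontier_D k hx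
    exact Set.mem_iUnion.2 ⟨⟨t, ht⟩, hxt⟩
  · refine lt_of_le_of_lt (liminf_le_of_le (by isBoundedDefault) (a := ENNReal.ofReal
      (M * (2 * radius) ^ expo β)) fun b hb => ?_) ENNReal.ofReal_lt_top
    obtain ⟨k, hk⟩ := hb.exists
    refine hk.trans ?_
    have h1 : ∀ t : bdry k 1, ediam (tile D k t) ^ expo β ≤
        ENNReal.ofReal ((2 * radius) ^ expo β * (β ^ k)⁻¹) := by
      intro t
      refine (ENNReal.rpow_le_rpow (ediam_tile_le k t) (expo_nonneg hβ)).trans_eq ?_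
      have := radius_pos
      have := ρ_pos
      rw [ENNReal.ofReal_rpow_of_nonneg (by positivity) (expo_nonneg hβ),
        Real.mul_rpow (by positivity) (by positivity), ρ_pow_rpow_expo hβ]
    refine (Finset.sum_le_card_nsmul _ _ _ fun t _ => h1 t).trans ?_
    rw [Finset.card_univ, Fintype.card_coe, nsmul_eq_mul, ← ENNReal.ofReal_natCast,
      ← ENNReal.ofReal_mul (Nat.cast_nonneg _)]
    refine ENNReal.ofReal_le_ofReal ?_
    have hk : 0 < β ^ k := by positivity
    calc ((bdry k 1).card : ℝ) * ((2 * radius) ^ expo β * (β ^ k)⁻¹)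
        ≤ M * β ^ k * ((2 * radius) ^ expo β * (β ^ k)⁻¹) := by
          have := radius_pos
          exact mul_le_mul_of_nonneg_right (hM k) (by positivity)
      _ = M * (2 * radius) ^ expo β := by field_simp

/-- The bound for `sep` that holds for two edges whose tiles meet a set of the diameter of the
edges. -/
noncomputable def sepBound : ℤ := ⌊(2 * (2 * radius + 1)) ^ 2⌋

/-- The number of edges within `sepBound` of a given edge. -/
noncomputable def sepCard : ℕ := (finite_sep_le sepBound).toFinset.card

/-- A set of diameter at most `ρ ^ k` meets few tiles on edges of the lattice `θ ^ k • ℤ[i]`. -/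
theorem card_le_sepCard {k : ℕ} {U : Set ℂ} (hU : ∀ x ∈ U, ∀ y ∈ U, dist x y ≤ ρ ^ k)
    {S : Finset Edge} (hS : ∀ e ∈ S, (tile D k e ∩ U).Nonempty) : S.card ≤ sepCard := by
  rcases S.eq_empty_or_nonempty with rfl | ⟨e, he⟩
  · exact Nat.zero_le _
  refine Finset.card_le_card_of_injOn (e⁻¹ * ·) (fun e' he' => ?_) fun _ _ _ _ h =>
    mul_left_cancel h
  obtain ⟨x, hx, hxU⟩ := hS e he
  obtain ⟨y, hy, hyU⟩ := hS e' he'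
  rw [Finset.mem_coe, Set.Finite.mem_toFinset, Set.mem_ofPred_eq, sep_one_inv_mul]
  exact Int.le_floor.2
    (sep_le_of_dist_le_of_mem_tile D_subset hx hy ((hU x hxU y hyU).trans_eq (mul_one _).symm))

/-- A set of diameter at most `ρ ^ k` contains the boundary points of few edges of `inner m`. -/
theorem card_filter_inner_le {k m : ℕ} (hkm : k ≤ m) {U : Set ℂ}
    (hU : ∀ x ∈ U, ∀ y ∈ U, dist x y ≤ ρ ^ k) {S : Finset Edge}
    (hS : ∀ t ∈ S, t ∈ inner m ∧ place m t 0 ∈ U) : S.card ≤ bdryCount (m - k) * sepCard := by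
  obtain ⟨n, rfl⟩ := Nat.exists_eq_add_of_le hkm
  rw [Nat.add_sub_cancel_left]
  refine (Finset.card_le_mul_card_image (f := parent^[n]) S (bdryCount n) ?_).trans
    (Nat.mul_le_mul_left _ (card_le_sepCard hU fun e he => ?_))
  · intro s _
    rw [← card_bdry n s]
    refine Finset.card_le_card fun t ht => ?_
    obtain ⟨ht, hs⟩ := Finset.mem_filter.1 ht
    exact hs ▸ mem_bdry_iterate_parent (inner_subset_bdry _ (hS t ht).1)
  · obtain ⟨t, ht, rfl⟩ := Finset.mem_image.1 he
    exact ⟨place (k + n) t 0, (mem_tile_iff D_eq (m := n)).2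
      ⟨t, mem_desc.2 rfl, 0, zero_mem_D, rfl⟩, (hS t ht).2⟩

/-- A lower bound for the size of finite coverings of the boundary of the dragon, obtained by
counting the boundary edges of a lattice that is finer than all sets of the covering. -/
theorem one_le_sum_of_cover {β M : ℝ} (hβ : 1 ≤ β)
    (hM : ∀ k, β ^ k ≤ (bdryCount k : ℝ) ∧ (bdryCount k : ℝ) ≤ M * β ^ k) {ι : Type*}
    (s : Finset ι) (U : ι → Set ℂ) (k : ι → ℕ)
    (hU : ∀ i ∈ s, ∀ x ∈ U i, ∀ y ∈ U i, dist x y ≤ ρ ^ k i)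
    (hs : frontier D ⊆ ⋃ i ∈ s, U i) :
    1 ≤ 120 * (sepCard * M) * ∑ i ∈ s, (β ^ k i)⁻¹ := by
  classical
  have hβ0 : 0 < β := by linarith
  set m := s.sup k
  have hkm : ∀ i ∈ s, k i ≤ m := fun i hi => Finset.le_sup hi
  have h1 : inner m ⊆ s.biUnion fun i => {t ∈ inner m | place m t 0 ∈ U i} := by
    intro t ht
    obtain ⟨i, hi, h⟩ := Set.mem_iUnion₂.1 (hs (place_mem_frontier_D ht))
    exact Finset.mem_biUnion.2 ⟨i, hi, Finset.mem_filter.2 ⟨ht, h⟩⟩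
  have h2 : (inner m).card ≤ ∑ i ∈ s, bdryCount (m - k i) * sepCard :=
    ((Finset.card_le_card h1).trans Finset.card_biUnion_le).trans
      (Finset.sum_le_sum fun i hi => card_filter_inner_le (hkm i hi) (hU i hi)
        fun t ht => Finset.mem_filter.1 ht)
  have h3 : (bdryCount m : ℝ) ≤ 120 * ∑ i ∈ s, (bdryCount (m - k i) * sepCard : ℝ) := by
    exact_mod_cast (bdryCount_le_card_inner m).trans (Nat.mul_le_mul_left _ h2)
  have h4 : ∑ i ∈ s, (bdryCount (m - k i) * sepCard : ℝ) ≤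
      ∑ i ∈ s, β ^ m * (sepCard * M * (β ^ k i)⁻¹) := by
    refine Finset.sum_le_sum fun i hi => ?_
    have h5 : β ^ m * (β ^ k i)⁻¹ = β ^ (m - k i) := by
      rw [pow_sub₀ β hβ0.ne' (hkm i hi)]
    calc (bdryCount (m - k i) * sepCard : ℝ) ≤ M * β ^ (m - k i) * sepCard :=
          mul_le_mul_of_nonneg_right (hM _).2 (Nat.cast_nonneg _)
      _ = _ := by rw [← h5]; ring
  rw [← Finset.mul_sum, ← Finset.mul_sum] at h4
  have h6 : 0 < β ^ m := by positivity
  refine le_of_mul_le_mul_left ?_ h6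
  calc β ^ m * 1 ≤ bdryCount m := by rw [mul_one]; exact (hM m).1
    _ ≤ _ := h3
    _ ≤ 120 * (β ^ m * (sepCard * M * ∑ i ∈ s, (β ^ k i)⁻¹)) := by gcongr
    _ = _ := by ring

/-- A scale `ρ ^ k` just above `d`, for which `β ^ (-k)` is comparable to `d ^ α` up to the error `ε`
that is needed when `d = 0`. -/
theorem exists_scale {β d ε : ℝ} (hβ : 1 ≤ β) (hd0 : 0 ≤ d) (hd1 : d < 1) (hε : 0 < ε) :
    ∃ k : ℕ, d < ρ ^ k ∧ (β ^ k)⁻¹ ≤ β * (d ^ expo β + ε) := by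
  have hc : ∀ᶠ δ in 𝓝[>] d, δ ^ expo β < d ^ expo β + ε :=
    ((Real.continuous_rpow_const (expo_nonneg hβ)).tendsto d |>.mono_left
      nhdsWithin_le_nhds).eventually_lt_const (by linarith)
  obtain ⟨δ, hδ, hδd, hδ1⟩ := (hc.and (Ioo_mem_nhdsGT hd1)).exists
  obtain ⟨k, hk1, hk2⟩ := exists_nat_pow_near_of_lt_one (hd0.trans_lt hδd) hδ1.le ρ_pos ρ_lt_one
  refine ⟨k, hδd.trans_le hk2, ?_⟩
  have h1 : (ρ ^ (k + 1)) ^ expo β ≤ δ ^ expo β :=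
    Real.rpow_le_rpow (pow_pos ρ_pos _).le hk1.le (expo_nonneg hβ)
  rw [ρ_pow_rpow_expo hβ] at h1
  have hβ0 : 0 < β := by linarith
  calc (β ^ k)⁻¹ = β * (β ^ (k + 1))⁻¹ := by rw [pow_succ]; field_simp
    _ ≤ _ := by gcongr; linarith

/-- The boundary of the dragon has positive measure, by compactness and the lower bound for finite
coverings. -/
theorem hausdorffMeasure_frontier_D_pos {β M : ℝ} (hβ : 1 ≤ β)
    (hM : ∀ k, β ^ k ≤ (bdryCount k : ℝ) ∧ (bdryCount k : ℝ) ≤ M * β ^ k) :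
    0 < μH[expo β] (frontier D) := by
  have hβ0 : 0 < β := by linarith
  -- every covering by sets of diameter at most `1 / 2` has at least the size `η`
  suffices h : ∃ η : ℝ, 0 < η ∧ ∀ t : ℕ → Set ℂ, frontier D ⊆ ⋃ n, t n →
      (∀ n, ediam (t n) ≤ 1 / 2) →
        ENNReal.ofReal η ≤ ∑' n, ⨆ _ : (t n).Nonempty, ediam (t n) ^ expo β by
    obtain ⟨η, hη, h⟩ := h
    refine (ENNReal.ofReal_pos.2 hη).trans_le ?_
    rw [Measure.hausdorffMeasure_apply]
    refine le_iSup₂_of_le (1 / 2) (by simp) ?_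
    exact le_iInf fun t => le_iInf fun ht => le_iInf fun htd => h t ht htd
  have hM1 : 1 ≤ M := by
    have := hM 0
    simp only [pow_zero, mul_one] at this
    exact this.1.trans this.2
  set C : ℝ := 120 * (sepCard * M) * β + 1 with hC
  have hC0 : 0 < C := by positivity
  refine ⟨1 / (2 * C), by positivity, fun t ht htd => ?_⟩
  set d : ℕ → ℝ := fun n => (ediam (t n)).toReal with hd
  have htop : ∀ n, ediam (t n) ≠ ⊤ := fun n => ((htd n).trans_lt (by simp)).ne
  have hd1 : ∀ n, d n < 1 := fun n => by
    have : d n ≤ 1 / 2 := ENNReal.toReal_le_of_le_ofReal (by norm_num)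
      ((htd n).trans_eq (by rw [ENNReal.ofReal_div_of_pos two_pos]; simp))
    linarith
  -- enlarge the sets of the covering slightly, to open sets of diameter at most `ρ ^ k n`
  obtain ⟨ε, hε, c, hc, hcC⟩ := NNReal.exists_pos_sum_of_countable
    (ε := ⟨1 / (2 * C), by positivity⟩) (fun h =>
      (by positivity : (0 : ℝ) < 1 / (2 * C)).ne' (congrArg NNReal.toReal h)) ℕ
  choose k hk1 hk2 using fun n => exists_scale hβ ENNReal.toReal_nonneg (hd1 n)
    (NNReal.coe_pos.2 (hε n))
  have hcov : frontier D ⊆ ⋃ n, thickening ((ρ ^ k n - d n) / 2) (t n) :=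
    ht.trans (Set.iUnion_mono fun n =>
      self_subset_thickening (by linarith [hk1 n] : 0 < (ρ ^ k n - d n) / 2) _)
  obtain ⟨s, hs⟩ := (isCompact_D.of_isClosed_subset isClosed_frontier
    isCompact_D.isClosed.frontier_subset).elim_finite_subcover _
    (fun n => isOpen_thickening) hcov
  classical
  have hs' : frontier D ⊆ ⋃ n ∈ s.filter fun n => (t n).Nonempty,
      thickening ((ρ ^ k n - d n) / 2) (t n) := by
    intro x hx
    obtain ⟨n, hn, hxn⟩ := Set.mem_iUnion₂.1 (hs hx)
    obtain ⟨y, hy, -⟩ := mem_thickening_iff.1 hxn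
    exact Set.mem_iUnion₂.2 ⟨n, Finset.mem_filter.2 ⟨hn, y, hy⟩, hxn⟩
  have h1 := one_le_sum_of_cover hβ hM _ _ k (fun n _ x hx y hy => ?_) hs'
  · have h2 : ∑ n ∈ s with (t n).Nonempty, (ε n : ℝ) ≤ 1 / (2 * C) := by
      have := (sum_le_hasSum (s.filter fun n => (t n).Nonempty)
        (fun n _ => zero_le) hc).trans hcC.le
      exact_mod_cast this
    have h3 : ∑ n ∈ s with (t n).Nonempty, (β ^ k n)⁻¹ ≤
        β * (∑ n ∈ s with (t n).Nonempty, d n ^ expo β + 1 / (2 * C)) := by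
      refine (Finset.sum_le_sum fun n _ => hk2 n).trans ?_
      rw [← Finset.mul_sum, Finset.sum_add_distrib]
      gcongr
    have h4 : 0 ≤ ∑ n ∈ s with (t n).Nonempty, d n ^ expo β :=
      Finset.sum_nonneg fun n _ => Real.rpow_nonneg ENNReal.toReal_nonneg _
    have h5 : 1 ≤ C * (∑ n ∈ s with (t n).Nonempty, d n ^ expo β + 1 / (2 * C)) := by
      refine h1.trans ?_
      calc _ ≤ 120 * (sepCard * M) *
            (β * (∑ n ∈ s with (t n).Nonempty, d n ^ expo β + 1 / (2 * C))) := by gcongr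
        _ = (C - 1) * (∑ n ∈ s with (t n).Nonempty, d n ^ expo β + 1 / (2 * C)) := by
          rw [hC]; ring
        _ ≤ _ := by gcongr; linarith
    have h6 : 1 / (2 * C) ≤ ∑ n ∈ s with (t n).Nonempty, d n ^ expo β := by
      rw [mul_add] at h5
      have h7 : C * (1 / (2 * C)) = 1 / 2 := by field_simp
      rw [div_le_iff₀ (by positivity)]
      linarith
    refine (ENNReal.ofReal_le_ofReal h6).trans ?_
    rw [ENNReal.ofReal_sum_of_nonneg fun n _ => Real.rpow_nonneg ENNReal.toReal_nonneg _]
    refine le_trans (Finset.sum_le_sum fun n hn => ?_)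
      (ENNReal.sum_le_tsum (s.filter fun n => (t n).Nonempty))
    refine le_iSup_of_le (Finset.mem_filter.1 hn).2 ?_
    rw [← ENNReal.ofReal_rpow_of_nonneg ENNReal.toReal_nonneg (expo_nonneg hβ),
      ENNReal.ofReal_toReal (htop n)]
  · obtain ⟨x', hx', hxx⟩ := mem_thickening_iff.1 hx
    obtain ⟨y', hy', hyy⟩ := mem_thickening_iff.1 hy
    have h7 : dist x' y' ≤ d n := by
      rw [dist_edist]
      exact ENNReal.toReal_mono (htop n) (edist_le_ediam_of_mem hx' hy')
    rw [dist_comm] at hyy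
    linarith [dist_triangle4 x x' y' y]

theorem frontier_K : frontier K = toPlane.toIsometryEquiv '' frontier D := by
  have h : frontier D = toPlane ⁻¹' frontier K := (toPlane.toHomeomorph.preimage_frontier K).symm
  rw [h]
  exact (Set.image_preimage_eq _ toPlane.surjective).symm

end LevyDragon

theorem mainTheorem2 :
    ∃ β : ℝ, 1 ≤ β ∧
      Filter.Tendsto (fun k : ℕ => ((LevyDragon.B k).ncard : ℝ) ^ (1 / (k : ℝ)))
        Filter.atTop (nhds β) ∧
      dimH (frontier LevyDragon.K) = ENNReal.ofReal (Real.log β / Real.log (√2)) ∧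
      0 < MeasureTheory.Measure.hausdorffMeasure (Real.log β / Real.log (√2))
        (frontier LevyDragon.K) ∧
      MeasureTheory.Measure.hausdorffMeasure (Real.log β / Real.log (√2))
        (frontier LevyDragon.K) < ⊤ := by
  obtain ⟨β, hβ, hb⟩ := LevyDragon.exists_growth_rate
    (u := fun k => (LevyDragon.Edge.bdryCount k : ℝ))
    (M := 120 * (120 * 36 * 120) * LevyDragon.Edge.bdryCount 18)
    (fun k => by exact_mod_cast LevyDragon.Edge.one_le_bdryCount k)
    (fun k m => by exact_mod_cast LevyDragon.Edge.bdryCount_add_le k m)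
    (fun k m => by exact_mod_cast LevyDragon.Edge.bdryCount_mul_le k m)
  have h0 : 0 < MeasureTheory.Measure.hausdorffMeasure (LevyDragon.expo β)
      (frontier LevyDragon.K) := by
    rw [LevyDragon.frontier_K, IsometryEquiv.hausdorffMeasure_image]
    exact LevyDragon.hausdorffMeasure_frontier_D_pos hβ hb
  have h1 : MeasureTheory.Measure.hausdorffMeasure (LevyDragon.expo β)
      (frontier LevyDragon.K) < ⊤ := by
    rw [LevyDragon.frontier_K, IsometryEquiv.hausdorffMeasure_image]
    exact LevyDragon.hausdorffMeasure_frontier_D_lt_top hβ fun k => (hb k).2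
  refine ⟨β, hβ, ?_, ?_, h0, h1⟩
  · refine LevyDragon.tendsto_rpow_one_div (by linarith) (c := 1 / 120) (by norm_num) fun k => ⟨?_,
      le_trans (Nat.cast_le.2 (LevyDragon.ncard_B_le_bdryCount k)) (hb k).2⟩
    have h2 : (LevyDragon.Edge.bdryCount k : ℝ) ≤ 120 * (LevyDragon.B k).ncard := by
      exact_mod_cast (LevyDragon.Edge.bdryCount_le_card_inner k).trans
        (Nat.mul_le_mul_left _ (LevyDragon.card_inner_le_ncard_B k))
    linarith [(hb k).1]
  · have h2 := LevyDragon.expo_nonneg hβ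
    rw [← Real.coe_toNNReal _ h2] at h0 h1
    exact dimH_of_hausdorffMeasure_ne_zero_ne_top h0.ne' h1.ne
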